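/- **Conventions.** An *ordered blueprint* $B=(B^\bullet,B^+,\le)$ is a commutative semiring $B^+$ with a partial order compatible with $+$ and $\cdot$, together with a multiplicative subset $B^\bullet\ni 0,1$ that generates $B^+$ as a semiring; we write $a\in B$ for $a\in B^\bullet$. An isomorphism of ordered blueprints is a semiring isomorphism $B^+\to C^+$ that preserves and reflects the order and identifies $B^\bullet$ with $C^\bullet$. For a set $S$ of relations $x\le y$ on $B^+$, the quotient $B/\!\!/\langle S\rangle$ is obtained from the smallest preorder on $B^+$ that contains $\le$ and $S$ and is closed under $+$ and $\cdot$, by identifying $x$ with $y$ whenever $x\le y\le x$. A subset of $B^\bullet$ generates a *subblueprint*: the submonoid generated by the subset and $0$, inside the subsemiring of $B^+$ that this submonoid generates, with the restricted order. $B$ is *pasteurized* if every $a\in B$ has a unique weak inverse $b\in B$, i.e. $0\le a+b$; the weak inverse of $1$ is denoted $\epsilon$. Let $\mathbb F_1^\pm=\{0,1,\epsilon\}/\!\!/\langle 0\le 1+\epsilon\rangle$ (with $\epsilon^2=1$, on the semiring $\mathbb N[\{1,\epsilon\}]$) and $\mathbb F_2=\{0,1\}/\!\!/\langle 0\le 1+1\rangle$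 (on the semiring $\mathbb N$). Let $M$ be a matroid of rank $r$ on a finite totally ordered set $E$, with set of bases $\mathcal B$. Its *weak universal pasture* is $$k_M^w=\Big(\mathbb F_1^\pm[x_I^{\pm1}\mid I\in\mathcal B]\,/\!\!/\,\mathcal Pl^w\Big)_0^{\pm},$$ where $\mathcal Pl^w$ consists of the $3$-term Plücker relations $$0\le x_{I_{12}}x_{I_{34}}+\epsilon\,x_{I_{13}}x_{I_{24}}+x_{I_{14}}x_{I_{23}}$$ for all $(r-2)$-subsets $I\subset E$ and $i_1<i_2<i_3<i_4$ in $E\setminus I$, with $I_{kl}=I\cup\{i_k,i_l\}$ and $x_J=0$ for $J\notin\mathcal B$; here $(-)_0$ is the subblueprint of elements of degree $0$ (each $x_I$ has degree $1$), and $(-)^\pm$ is pasteurization, which identifies $a$ and $a'$ whenever $0\le a+b$ and $0\le a'+b$ for some $b$. The *foundation* $k_M^f$ is the subblueprint of $k_M^w$ generated by its fundamental elements, i.e. those $a\in k_M^w$ for which $0\le a+b+\epsilon^i$ for some $b\in k_M^w$ and $i\in\{0,1\}$. $M$ is *strongly representable* over $\mathbb F_2$ if there is a function $\Delta:\binom Er\to\mathbb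 F_2$ whose support $\{I\mid\Delta(I)\neq0\}$ is $\mathcal B$ and which satisfies all Plücker relations $0\le\sum_{k=0}^r\epsilon^k\Delta(I\setminus\{i_k\})\Delta(J\cup\{i_k\})$ for all $J\in\binom E{r-1}$ and $I=\{i_0<\dots<i_r\}\in\binom E{r+1}$ (with $\Delta(J\cup\{i_k\})=0$ if $i_k\in J$). It is *weakly representable* over $\mathbb F_2$ if there is such a $\Delta$ with support $\mathcal B$ for which only the $3$-term Plücker relations $0\le\Delta(I_{12})\Delta(I_{34})+\epsilon\Delta(I_{13})\Delta(I_{24})+\Delta(I_{14})\Delta(I_{23})$ (index set as above) are required. A matroid is *binary* if it is representable over $\mathbb F_2$; weak and strong representability over $\mathbb F_2$ agree. **Theorem.** Let $M$ be a matroid on a finite totally ordered set. Then $M$ is binary, in the sense of strong representability over $\mathbb F_2$, if and only if its foundation $k_M^f$ is isomorphic, as an ordered blueprint, to $\mathbb F_1^\pm$ or to $\mathbb F_2$. The same equivalence holds with weak in place of strong representability. -/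

import Mathlib

universe u v

/-- An ordered blueprint `B = (B^•, B^+, ≤)`: a commutative semiring `Amb = B^+` with a partial
order compatible with addition and multiplication, together with a multiplicative subset
`mon = B^•` that contains `0` and `1` and generates `B^+` as a semiring. -/
structure OrdBlpr : Type (u + 1) where
  Amb : Type u
  semiring : CommSemiring Amb
  order : PartialOrder Amb
  add_le_add' : ∀ x y z t : Amb, x ≤ y → z ≤ t → x + z ≤ y + t
  mul_le_mul' : ∀ x y z t : Amb, x ≤ y → z ≤ t → x * z ≤ y * t
  mon : Submonoid Amb
  zero_mem' : (0 : Amb) ∈ mon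
  closure_eq_top : Subsemiring.closure (mon : Set Amb) = ⊤

namespace OrdBlpr

attribute [instance] OrdBlpr.semiring OrdBlpr.order

/-- Isomorphism of ordered blueprints: a semiring isomorphism that preserves and reflects the
order and the underlying monoids. -/
def IsIso (B : OrdBlpr.{u}) (C : OrdBlpr.{v}) : Prop :=
  ∃ f : B.Amb ≃+* C.Amb, (∀ x y : B.Amb, f x ≤ f y ↔ x ≤ y) ∧
    ∀ x : B.Amb, f x ∈ C.mon ↔ x ∈ B.mon

/-- The ordered blueprint `(G ∪ {0}, ℕ[G], =)` of the monoid with zero `G ∪ {0}`, for an abelian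
group `G`. -/
noncomputable def ofGroup (G : Type u) [CommGroup G] : OrdBlpr.{u} where
  Amb := MonoidAlgebra ℕ G
  semiring := inferInstance
  order :=
    { le := fun x y => x = y
      le_refl := fun _ => rfl
      le_trans := fun _ _ _ h h' => h.trans h'
      le_antisymm := fun _ _ h _ => h }
  add_le_add' := fun _ _ _ _ h h' => congrArg₂ (· + ·) h h'
  mul_le_mul' := fun _ _ _ _ h h' => congrArg₂ (· * ·) h h'
  mon :=
    { carrier := {x | x = 0 ∨ ∃ g : G, x = MonoidAlgebra.single g 1}
      one_mem' := Or.inr ⟨1, rfl⟩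
      mul_mem' := by
        rintro _ _ (rfl | ⟨g, rfl⟩) (rfl | ⟨h, rfl⟩)
        · simp
        · simp
        · simp
        · exact Or.inr ⟨g * h, by simp⟩ }
  zero_mem' := Or.inl rfl
  closure_eq_top := by
    rw [eq_top_iff]
    rintro x -
    induction x using MonoidAlgebra.induction_on with
    | of g => exact Subsemiring.subset_closure (Or.inr ⟨g, rfl⟩)
    | add x y hx hy => exact add_mem hx hy
    | smul n x hx => exact nsmul_mem hx n

/-- The smallest preorder on `B^+` that contains the partial order of `B` and the relations `S`
and that is closed under addition and multiplication. -/
inductive GenLE (B : OrdBlpr.{u}) (S : B.Amb → B.Amb → Prop) : B.Amb → B.Amb → Prop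
  | of_le {x y : B.Amb} : x ≤ y → GenLE B S x y
  | of_rel {x y : B.Amb} : S x y → GenLE B S x y
  | trans {x y z : B.Amb} : GenLE B S x y → GenLE B S y z → GenLE B S x z
  | add {x y z t : B.Amb} : GenLE B S x y → GenLE B S z t → GenLE B S (x + z) (y + t)
  | mul {x y z t : B.Amb} : GenLE B S x y → GenLE B S z t → GenLE B S (x * z) (y * t)

/-- The congruence `x ≡ y` if and only if `x ≤ y` and `y ≤ x` in the generated preorder. -/
def genCon (B : OrdBlpr.{u}) (S : B.Amb → B.Amb → Prop) : RingCon B.Amb where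
  r x y := GenLE B S x y ∧ GenLE B S y x
  iseqv :=
    { refl := fun _ => ⟨.of_le le_rfl, .of_le le_rfl⟩
      symm := fun h => ⟨h.2, h.1⟩
      trans := fun h h' => ⟨h.1.trans h'.1, h'.2.trans h.2⟩ }
  add' h h' := ⟨h.1.add h'.1, h.2.add h'.2⟩
  mul' h h' := ⟨h.1.mul h'.1, h.2.mul h'.2⟩

/-- The quotient `B // ⟨S⟩` of an ordered blueprint by a set `S` of relations `x ≤ y`. -/
def quot (B : OrdBlpr.{u}) (S : B.Amb → B.Amb → Prop) : OrdBlpr.{u} where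
  Amb := (genCon B S).Quotient
  semiring := inferInstance
  order :=
    { le := fun a b => Quotient.liftOn₂ a b (GenLE B S) fun _ _ _ _ h h' => propext
        ⟨fun k => (h.2.trans k).trans h'.1, fun k => (h.1.trans k).trans h'.2⟩
      le_refl := by
        rintro ⟨x⟩
        exact GenLE.of_le le_rfl
      le_trans := by
        rintro ⟨x⟩ ⟨y⟩ ⟨z⟩ h h'
        exact GenLE.trans h h'
      le_antisymm := by
        rintro ⟨x⟩ ⟨y⟩ h h'
        exact (RingCon.eq _).2 ⟨h, h'⟩ }
  add_le_add' := by
    rintro ⟨x⟩ ⟨y⟩ ⟨z⟩ ⟨t⟩ h h'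
    exact GenLE.add h h'
  mul_le_mul' := by
    rintro ⟨x⟩ ⟨y⟩ ⟨z⟩ ⟨t⟩ h h'
    exact GenLE.mul h h'
  mon := B.mon.map (genCon B S).mk'
  zero_mem' := ⟨0, B.zero_mem', map_zero _⟩
  closure_eq_top := by
    have h := RingHom.map_closureS (genCon B S).mk' (B.mon : Set B.Amb)
    rw [B.closure_eq_top] at h
    change Subsemiring.closure ((genCon B S).mk' '' (B.mon : Set B.Amb)) = ⊤
    rw [← h, eq_top_iff]
    rintro x -
    obtain ⟨y, rfl⟩ := (genCon B S).mk'_surjective x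
    exact ⟨y, trivial, rfl⟩

/-- The subblueprint `C` of `B` generated by a set `X ⊆ B^•`: its underlying monoid is the
submonoid generated by `X` and `0`, its semiring `C^+` is the subsemiring of `B^+` generated by
that submonoid, and its order is the restriction of the order of `B^+`. -/
def sub (B : OrdBlpr.{u}) (X : Set B.Amb) : OrdBlpr.{u} where
  Amb := Subsemiring.closure (Submonoid.closure (insert 0 X) : Set B.Amb)
  semiring := inferInstance
  order := inferInstance
  add_le_add' := fun _ _ _ _ h h' => B.add_le_add' _ _ _ _ h h'
  mul_le_mul' := fun _ _ _ _ h h' => B.mul_le_mul' _ _ _ _ h h'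
  mon := (Submonoid.closure (insert 0 X)).comap
    (Subsemiring.closure (Submonoid.closure (insert 0 X) : Set B.Amb)).subtype
  zero_mem' := Submonoid.subset_closure (Set.mem_insert 0 X)
  closure_eq_top := by
    rw [eq_top_iff]
    rintro ⟨x, hx⟩ -
    induction hx using Subsemiring.closure_induction with
    | mem y hy => exact Subsemiring.subset_closure hy
    | zero => exact zero_mem _
    | one => exact one_mem _
    | add y z _ _ hy hz => exact add_mem hy hz
    | mul y z _ _ hy hz => exact mul_mem hy hz

/-- `e ∈ B^•` is a weak inverse of `1`, that is `0 ≤ 1 + e`. In a pasteurized ordered blueprint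
the only such element is `ε`. -/
def IsEps (B : OrdBlpr.{u}) (e : B.Amb) : Prop :=
  e ∈ B.mon ∧ 0 ≤ 1 + e

/-- The pasteurization of an ordered blueprint `B` over `F₁^±`, in which every element `a` has
the weak inverse `ε a`: two elements with a common weak inverse are identified. -/
def pasteurize (B : OrdBlpr.{u}) : OrdBlpr.{u} :=
  B.quot fun a a' => a ∈ B.mon ∧ a' ∈ B.mon ∧ ∃ b ∈ B.mon, 0 ≤ a + b ∧ 0 ≤ a' + b

/-- A fundamental element of a pasteurized ordered blueprint `B` is an element `a` of `B^•` such
that `0 ≤ a + b + ε ^ i` for some `b ∈ B^•` and some `i ∈ {0, 1}`. -/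
def IsFundamental (B : OrdBlpr.{u}) (a : B.Amb) : Prop :=
  a ∈ B.mon ∧ ∃ b ∈ B.mon, ∃ e : B.Amb, B.IsEps e ∧ ∃ i : Fin 2, 0 ≤ a + b + e ^ (i : ℕ)

/-- The foundation of a pasteurized ordered blueprint is the subblueprint generated by its
fundamental elements. -/
def found (B : OrdBlpr.{u}) : OrdBlpr.{u} :=
  B.sub {a | B.IsFundamental a}

/-- `F₁^± = {0, 1, ε} // ⟨0 ≤ 1 + ε⟩`, where `ε = -1` in the group `ℤˣ = {1, -1}`. -/
noncomputable def F1pm : OrdBlpr.{0} :=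
  (ofGroup ℤˣ).quot fun x y : MonoidAlgebra ℕ ℤˣ =>
    x = 0 ∧ y = 1 + MonoidAlgebra.single (-1 : ℤˣ) 1

/-- The field with two elements as a pasture, `F₂ = {0, 1} // ⟨0 ≤ 1 + 1⟩`. -/
noncomputable def F2 : OrdBlpr.{0} :=
  (ofGroup Unit).quot fun x y : MonoidAlgebra ℕ Unit => x = 0 ∧ y = 1 + 1

end OrdBlpr

namespace BinaryFoundation

variable {E : Type u} [LinearOrder E]

/-- The expression `Δ(I₁₂) Δ(I₃₄) + ε Δ(I₁₃) Δ(I₂₄) + Δ(I₁₄) Δ(I₂₃)` of the `3`-term Plücker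
relation, where `I_{kl} = I ∪ {i_k, i_l}`. -/
def threeTerm {R : Type v} [CommSemiring R] (e : R) (D : Finset E → R)
    (I : Finset E) (i₁ i₂ i₃ i₄ : E) : R :=
  D (I ∪ {i₁, i₂}) * D (I ∪ {i₃, i₄}) + e * (D (I ∪ {i₁, i₃}) * D (I ∪ {i₂, i₄})) +
    D (I ∪ {i₁, i₄}) * D (I ∪ {i₂, i₃})

/-- The index set of the `3`-term Plücker relations of rank `r`: `I` is an `(r-2)`-subset and
`i₁ < i₂ < i₃ < i₄` are elements outside of `I`. -/
def IsIndex (r : ℕ) (I : Finset E) (i₁ i₂ i₃ i₄ : E) : Prop :=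
  I.card + 2 = r ∧ i₁ < i₂ ∧ i₂ < i₃ ∧ i₃ < i₄ ∧ i₁ ∉ I ∧ i₂ ∉ I ∧ i₃ ∉ I ∧ i₄ ∉ I

/-- The rank of a matroid on a finite set. -/
noncomputable def rk (M : Matroid E) : ℕ := M.eRank.toNat

/-- `M` is weakly representable over the pasture `F`: there is a weak Grassmann-Plücker function
with coefficients in `F` whose support is the set of bases of `M`. A function on the `r`-subsets
of `E` is extended by `0` to all finite subsets. -/
def WeaklyRepresentable (M : Matroid E) (F : OrdBlpr.{v}) : Prop :=
  ∃ e : F.Amb, F.IsEps e ∧ ∃ D : Finset E → F.Amb,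
    (∀ B : Finset E, D B ∈ F.mon) ∧
    (∀ B : Finset E, D B ≠ 0 ↔ M.IsBase (B : Set E)) ∧
    ∀ (I : Finset E) (i₁ i₂ i₃ i₄ : E), IsIndex (rk M) I i₁ i₂ i₃ i₄ →
      0 ≤ threeTerm e D I i₁ i₂ i₃ i₄

/-- `M` is (strongly) representable over the pasture `F`: there is a Grassmann-Plücker function
with coefficients in `F` whose support is the set of bases of `M`. All Plücker relations
`0 ≤ ∑ ε ^ k Δ(I - {i_k}) Δ(J ∪ {i_k})` are required, for every `(r-1)`-subset `J` and every
`(r+1)`-subset `I = {i_0 < ⋯ < i_r}`, where `Δ(J ∪ {i_k})` is read as `0` if `i_k ∈ J`. -/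
def StronglyRepresentable (M : Matroid E) (F : OrdBlpr.{v}) : Prop :=
  ∃ e : F.Amb, F.IsEps e ∧ ∃ D : Finset E → F.Amb,
    (∀ B : Finset E, D B ∈ F.mon) ∧
    (∀ B : Finset E, D B ≠ 0 ↔ M.IsBase (B : Set E)) ∧
    ∀ (J I : Finset E) (_ : J.card + 1 = rk M) (hI : I.card = rk M + 1),
      0 ≤ ∑ k : Fin (rk M + 1),
        if I.orderEmbOfFin hI k ∈ J then 0
        else e ^ (k : ℕ) * (D (I.erase (I.orderEmbOfFin hI k)) *
          D (insert (I.orderEmbOfFin hI k) J))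

/-- The set of bases of `M`. -/
abbrev Base (M : Matroid E) : Type u := {B : Finset E // M.IsBase (B : Set E)}

/-- The group of Laurent monomials `ε ^ i ∏ x_B ^ (e_B)`, with `i ∈ {0, 1}` and `e_B ∈ ℤ`, in
variables `x_B` indexed by the bases `B` of `M`. -/
abbrev Mono (M : Matroid E) : Type u := ℤˣ × Multiplicative (Base M →₀ ℤ)

/-- The total degree `∑ e_B` of a Laurent monomial. -/
def deg {M : Matroid E} (g : Mono M) : ℤ := (Multiplicative.toAdd g.2).sum fun _ n => n

open Classical in
/-- The variable `x_B` if `B` is a basis of `M`, and `0` otherwise. -/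
noncomputable def coord (M : Matroid E) (B : Finset E) : MonoidAlgebra ℕ (Mono M) :=
  if h : M.IsBase (B : Set E) then
    MonoidAlgebra.single (1, Multiplicative.ofAdd (Finsupp.single ⟨B, h⟩ 1)) 1
  else 0

/-- The element `ε` among the Laurent polynomials. -/
noncomputable def eps (M : Matroid E) : MonoidAlgebra ℕ (Mono M) :=
  MonoidAlgebra.single (-1, 1) 1

/-- `F₁^±[x_B^{±1} | B a basis of M] // (3-term Plücker relations)`. -/
noncomputable def coordBlpr (M : Matroid E) : OrdBlpr.{u} :=
  (OrdBlpr.ofGroup (Mono M)).quot fun x y : MonoidAlgebra ℕ (Mono M) =>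
    x = 0 ∧ (y = 1 + eps M ∨ ∃ (I : Finset E) (i₁ i₂ i₃ i₄ : E),
      IsIndex (rk M) I i₁ i₂ i₃ i₄ ∧ y = threeTerm (eps M) (coord M) I i₁ i₂ i₃ i₄)

/-- The class of a Laurent monomial in `coordBlpr M`. -/
noncomputable def coordBlpr.monomial (M : Matroid E) (g : Mono M) : (coordBlpr M).Amb :=
  RingCon.toQuotient (MonoidAlgebra.single g 1 : MonoidAlgebra ℕ (Mono M))

/-- The residue field at the weak support of `M`: the degree-`0` part of `coordBlpr M`. -/
noncomputable def weakResidue (M : Matroid E) : OrdBlpr.{u} :=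
  (coordBlpr M).sub {a | ∃ g : Mono M, deg g = 0 ∧ a = coordBlpr.monomial M g}

/-- The weak universal pasture `k_M^w` of `M`. -/
noncomputable def weakUniversalPasture (M : Matroid E) : OrdBlpr.{u} :=
  (weakResidue M).pasteurize

/-- The foundation `k_M^f` of `M`. -/
noncomputable def foundation (M : Matroid E) : OrdBlpr.{u} :=
  (weakUniversalPasture M).found

end BinaryFoundation

/-! A sum of elements of the monoid of `F2` is nonnegative exactly when it has an even number of
nonzero terms, and a function with values in {0, 1} is determined by its support. Hence weak and
strong representability over `F2` say that the basis indicator satisfies the three-term,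
respectively all, Plücker relations modulo two: `ThreeTermMod2` and `PluckerMod2`.

These conditions agree. In the substantial direction, `ThreeTermMod2.pluckerMod2`, the three-term
relations say that a basis exchange acts on the fundamental matrix by row operations. Orthogonality
to all rows is therefore independent of the basis, and a general Plücker relation is such an
orthogonality, easily checked at one particular basis.

If the foundation is `F1pm` or `F2`, it has a parity. A three-term relation with one or three
surviving terms would become, after division by a term, 0 ≤ 1 or 0 ≤ a + b + 1 in the weak universal
pasture, where a and b are fundamental and invertible. The parity excludes both, so every relation
has zero or two surviving terms.

Conversely, a two-term relation 0 ≤ g + h says that h/g is a weak inverse of 1, so pasteurization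
forces h = εg. Thus all relations reduce to 0 ≤ 1 + ε, and the pasture maps monotonically to a group
semiring whose order is explicit (`ThreeTermMod2.exists_hom`). There nonnegative elements have even
mass, so three monomials never sum to something nonnegative and the fundamental elements are only 0,
1 and ε. The foundation is then `F2` or `F1pm` according to whether ε = 1 or not. -/

namespace BinaryFoundation

/-! ### Plücker relations modulo two -/

/-- In characteristic two, the sorted three-term relations of a symmetric function that vanishes
on the diagonal imply all three-term relations. -/
lemma three_term_of_lt {E : Type*} [LinearOrder E] (g : E → E → ZMod 2)
    (hs : ∀ a b, g a b = g b a) (hd : ∀ a, g a a = 0)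
    (h : ∀ a b c d, a < b → b < c → c < d → g a b * g c d + g a c * g b d + g a d * g b c = 0)
    (a b c d : E) : g a b * g c d + g a c * g b d + g a d * g b c = 0 := by
  have two (x : ZMod 2) : x + x = 0 := CharTwo.add_self_eq_zero x
  -- The expression is invariant under permutations of the four indices, so `a` may be taken least
  -- and `c ≤ d`. If two indices coincide, one product vanishes and the other two cancel.
  wlog h₁ : a ≤ b generalizing a b
  · rw [← this b a (not_le.1 h₁).le, hs a b]; ring
  wlog h₂ : c ≤ d generalizing c d
  · rw [← this d c (not_le.1 h₂).le, hs c d]; ring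
  wlog h₃ : a ≤ c generalizing a b c d
  · rw [← this c d h₂ a b h₁ (not_le.1 h₃).le, hs a c, hs b d, hs a d, hs b c]; ring
  rcases h₁.eq_or_lt with rfl | h₁
  · rw [hd, zero_mul, zero_add, mul_comm, two]
  rcases h₂.eq_or_lt with rfl | h₂
  · rw [hd, mul_zero, zero_add, mul_comm, two]
  rcases h₃.eq_or_lt with rfl | h₃
  · rw [hd, hs b a, zero_mul, add_zero, mul_comm, two]
  rcases lt_trichotomy b c with h₄ | rfl | h₄
  · exact h a b c d h₁ h₄ h₂
  · rw [hd, mul_zero, add_zero, two]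
  rcases lt_trichotomy b d with h₅ | rfl | h₅
  · rw [← h a c b d h₃ h₄ h₅, hs c b]; ring
  · rw [hd, mul_zero, add_zero, hs c b, mul_comm, two]
  · rw [← h a c d b h₃ h₂ h₅, hs c b, hs d b]; ring

variable {E : Type u}

open Classical in
/-- The indicator function of the bases of `M` with values in the integers modulo two. -/
noncomputable def baseInd (M : Matroid E) (B : Finset E) : ZMod 2 :=
  if M.IsBase (B : Set E) then 1 else 0

lemma baseInd_of_isBase {M : Matroid E} {B : Finset E} (h : M.IsBase (B : Set E)) :
    baseInd M B = 1 := if_pos h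

lemma isBase_of_baseInd_ne_zero {M : Matroid E} {B : Finset E} (h : baseInd M B ≠ 0) :
    M.IsBase (B : Set E) := by
  by_contra hB
  exact h (if_neg hB)

lemma card_of_isBase {M : Matroid E} {B : Finset E} (h : M.IsBase (B : Set E)) :
    B.card = rk M := by
  have := h.encard_eq_eRank
  rw [Set.encard_coe_eq_coe_finsetCard] at this
  rw [rk, ← this, ENat.toNat_natCast]

lemma baseInd_of_card_ne {M : Matroid E} {B : Finset E} (h : B.card ≠ rk M) :
    baseInd M B = 0 := if_neg fun hB => h (card_of_isBase hB)

variable [LinearOrder E]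

/-- The basis indicator satisfies the three-term Plücker relations modulo two. -/
def ThreeTermMod2 (M : Matroid E) : Prop :=
  ∀ (I : Finset E) (i₁ i₂ i₃ i₄ : E), IsIndex (rk M) I i₁ i₂ i₃ i₄ →
    threeTerm 1 (baseInd M) I i₁ i₂ i₃ i₄ = 0

/-- The basis indicator satisfies all Plücker relations modulo two. -/
def PluckerMod2 (M : Matroid E) : Prop :=
  ∀ J I : Finset E, J.card + 1 = rk M → I.card = rk M + 1 →
    ∑ i ∈ I, baseInd M (I.erase i) * baseInd M (insert i J) = 0

/-- Take the Plücker relation of I ∪ {a} and I ∪ {b, c, d}. The summands indexed by I vanish because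
the second factor is evaluated on a set with too few elements, which leaves three terms. -/
lemma PluckerMod2.threeTermMod2 {M : Matroid E} (h : PluckerMod2 M) : ThreeTermMod2 M := by
  rintro I a b c d ⟨hc, hab, hbc, hcd, ha, hb, hc', hd⟩
  have hac := hab.trans hbc
  have hbd := hbc.trans hcd
  have had := hac.trans hcd
  have key := h (insert a I) (insert b (insert c (insert d I)))
    (by rw [Finset.card_insert_of_notMem ha]; omega)
    (by rw [Finset.card_insert_of_notMem, Finset.card_insert_of_notMem,
          Finset.card_insert_of_notMem hd]
        · omega
        · simp [hcd.ne, hc']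
        · simp [hbc.ne, hbd.ne, hb])
  rw [Finset.sum_insert (by simp [hbc.ne, hbd.ne, hb]), Finset.sum_insert (by simp [hcd.ne, hc']),
    Finset.sum_insert hd, Finset.sum_eq_zero (s := I)] at key
  · have e1 : (insert b (insert c (insert d I))).erase b = I ∪ {c, d} := by
      rw [Finset.erase_insert (by simp [hbc.ne, hbd.ne, hb])]; ext; simp
    have e2 : (insert b (insert c (insert d I))).erase c = I ∪ {b, d} := by
      ext x; by_cases hx : x = c
      · subst hx; simp [hbc.ne', hcd.ne, hc']
      · simp [hx]
    have e3 : (insert b (insert c (insert d I))).erase d = I ∪ {b, c} := by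
      ext x; by_cases hx : x = d
      · subst hx; simp [hbd.ne', hcd.ne', hd]
      · simp [hx]
    have e4 (x : E) : insert x (insert a I) = I ∪ {a, x} := by ext; simp; tauto
    rw [e1, e2, e3, e4, e4, e4] at key
    rw [threeTerm, ← key]
    ring
  · intro i hi
    rw [baseInd_of_card_ne (B := insert i (insert a I)), mul_zero]
    rw [Finset.insert_eq_of_mem (Finset.mem_insert_of_mem hi), Finset.card_insert_of_notMem ha]
    omega

/-- Signs are invisible modulo two, and a set with a repeated index, or an index already in `K`, is
too small to be a basis. So order and distinctness of the indices can be dropped. -/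
lemma ThreeTermMod2.unordered {M : Matroid E} (h : ThreeTermMod2 M) {K : Finset E}
    (hK : K.card + 2 = rk M) (a b c d : E) :
    baseInd M (insert a (insert b K)) * baseInd M (insert c (insert d K)) +
      baseInd M (insert a (insert c K)) * baseInd M (insert b (insert d K)) +
      baseInd M (insert a (insert d K)) * baseInd M (insert b (insert c K)) = 0 := by
  have hmem (x y : E) (hx : x ∈ K) : baseInd M (insert x (insert y K)) = 0 := by
    apply baseInd_of_card_ne
    rw [Finset.insert_eq_of_mem (Finset.mem_insert_of_mem hx)]
    have := Finset.card_insert_le y K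
    omega
  have hmem' (x y : E) (hx : x ∈ K) : baseInd M (insert y (insert x K)) = 0 := by
    rw [Finset.insert_comm]; exact hmem x y hx
  refine three_term_of_lt (fun x y => baseInd M (insert x (insert y K)))
    (fun x y => by rw [Finset.insert_comm]) (fun x => ?_) (fun a b c d hab hbc hcd => ?_) a b c d
  · apply baseInd_of_card_ne
    rw [Finset.insert_idem]
    have := Finset.card_insert_le x K
    omega
  by_cases ha : a ∈ K
  · simp [hmem _ _ ha]
  by_cases hb : b ∈ K
  · simp [hmem _ _ hb, hmem' _ _ hb]
  by_cases hc : c ∈ K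
  · simp [hmem _ _ hc, hmem' _ _ hc]
  by_cases hd : d ∈ K
  · simp [hmem' _ _ hd]
  have := h K a b c d ⟨hK, hab, hbc, hcd, ha, hb, hc, hd⟩
  have e (x y : E) : K ∪ {x, y} = insert x (insert y K) := by ext; simp
  simpa only [threeTerm, e, one_mul] using this

/-- The row of the fundamental matrix at the basis `B` and `y ∈ B`, after the exchange of `b`
against `x`. -/
lemma ThreeTermMod2.exchange_row {M : Matroid E} (h : ThreeTermMod2 M) {B : Finset E} {b x y : E}
    (hB : M.IsBase (B : Set E)) (hb : b ∈ B) (hy : y ∈ B) (hyb : y ≠ b)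
    (hB' : M.IsBase (insert x (B.erase b) : Finset E)) (e : E) :
    baseInd M (insert e ((insert x (B.erase b)).erase y)) =
      baseInd M (insert e (B.erase y)) +
        baseInd M (insert x (B.erase y)) * baseInd M (insert e (B.erase b)) := by
  have hx : x ∉ B.erase b := by
    intro hx
    have h₁ := card_of_isBase hB'
    rw [Finset.insert_eq_of_mem hx, ← card_of_isBase hB, Finset.card_erase_of_mem hb] at h₁
    have := Finset.card_pos.2 ⟨b, hb⟩
    omega
  have hxy : x ≠ y := by
    rintro rfl
    exact hx (Finset.mem_erase.2 ⟨hyb, hy⟩)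
  set K := (B.erase b).erase y with hKdef
  have hyb' : y ∈ B.erase b := Finset.mem_erase.2 ⟨hyb, hy⟩
  have hK : K.card + 2 = rk M := by
    rw [hKdef, Finset.card_erase_of_mem hyb', Finset.card_erase_of_mem hb, ← card_of_isBase hB]
    have := Finset.card_pos.2 ⟨y, hyb'⟩
    rw [Finset.card_erase_of_mem hb] at this
    omega
  have e₁ : (insert x (B.erase b)).erase y = insert x K := by
    rw [Finset.erase_insert_of_ne hxy]
  have e₂ : B.erase y = insert b K := by
    rw [hKdef, Finset.erase_right_comm, Finset.insert_erase]
    exact Finset.mem_erase.2 ⟨hyb.symm, hb⟩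
  have e₃ : B.erase b = insert y K := by rw [hKdef, Finset.insert_erase hyb']
  have e₄ : B = insert b (insert y K) := by rw [← e₃, Finset.insert_erase hb]
  have d₁ : baseInd M (insert b (insert y K)) = 1 := by rw [← e₄]; exact baseInd_of_isBase hB
  have d₂ : baseInd M (insert x (insert y K)) = 1 := by rw [← e₃]; exact baseInd_of_isBase hB'
  -- Two of the six factors are 1, namely those at `B` and at the exchanged basis; solving for the
  -- factor at {e, x} gives the claim.
  have key := h.unordered hK b y e x
  rw [d₁, Finset.insert_comm y x, d₂, Finset.insert_comm y e, Finset.insert_comm b e,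
    Finset.insert_comm b x] at key
  rw [e₁, e₂, e₃, ← sub_eq_zero, ← key, sub_eq_add_neg, CharTwo.neg_eq]
  ring

/-- The pairing of the vector `w`, supported on `I`, with the indicator of the elements that
complete `J` to a basis. -/
noncomputable def rowPairing (M : Matroid E) (I : Finset E) (w : E → ZMod 2) (J : Finset E) :
    ZMod 2 :=
  ∑ i ∈ I, w i * baseInd M (insert i J)

/-- A vector that is orthogonal to the rows of the fundamental matrix at one basis is orthogonal
to the rows of the fundamental matrix at an adjacent basis. -/
lemma ThreeTermMod2.rowPairing_exchange {M : Matroid E} (h : ThreeTermMod2 M) {I : Finset E}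
    {w : E → ZMod 2} {B : Finset E} {b x : E} (hB : M.IsBase (B : Set E)) (hb : b ∈ B)
    (hB' : M.IsBase (insert x (B.erase b) : Finset E))
    (hw : ∀ y ∈ B, rowPairing M I w (B.erase y) = 0) :
    ∀ y ∈ insert x (B.erase b), rowPairing M I w ((insert x (B.erase b)).erase y) = 0 := by
  have hx : x ∉ B.erase b := by
    intro hx
    have h₁ := card_of_isBase hB'
    rw [Finset.insert_eq_of_mem hx, ← card_of_isBase hB, Finset.card_erase_of_mem hb] at h₁
    have := Finset.card_pos.2 ⟨b, hb⟩
    omega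
  intro y hy
  -- The row of the new element is the old row of `b`; every other row is its old row plus a
  -- multiple of the row of `b`.
  rcases Finset.mem_insert.1 hy with rfl | hy
  · rw [Finset.erase_insert hx]
    exact hw b hb
  · have hyb := Finset.ne_of_mem_erase hy
    have hyB := Finset.mem_of_mem_erase hy
    have h₁ := hw y hyB
    have h₂ := hw b hb
    rw [rowPairing] at h₁ h₂ ⊢
    simp_rw [h.exchange_row hB hb hyB hyb hB', mul_add, Finset.sum_add_distrib]
    rw [h₁, zero_add]
    simp_rw [mul_left_comm _ (baseInd M (insert x (B.erase y)))]
    rw [← Finset.mul_sum, h₂, mul_zero]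

/-- Any basis `A` is reached from `B` by successive exchanges: replacing an element of `A \ B` by
one of `B` gives a basis nearer to `B`, and orthogonality passes along that last exchange. -/
lemma ThreeTermMod2.rowPairing_eq_zero {M : Matroid E} (h : ThreeTermMod2 M) {I : Finset E}
    {w : E → ZMod 2} {B : Finset E} (hB : M.IsBase (B : Set E))
    (hw : ∀ y ∈ B, rowPairing M I w (B.erase y) = 0) (n : ℕ) :
    ∀ A : Finset E, (A \ B).card = n → M.IsBase (A : Set E) →
      ∀ y ∈ A, rowPairing M I w (A.erase y) = 0 := by
  induction n with
  | zero =>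
    intro A hn hA
    have : A ⊆ B := by rwa [Finset.card_eq_zero, Finset.sdiff_eq_empty_iff_subset] at hn
    have : A = B := Finset.coe_injective
      (hA.eq_of_subset_isBase hB (Finset.coe_subset.2 this))
    rw [this]
    exact hw
  | succ n ih =>
    intro A hn hA
    obtain ⟨a, ha⟩ := Finset.card_pos.1 (by omega : 0 < (A \ B).card)
    rw [Finset.mem_sdiff] at ha
    obtain ⟨x, hx, hA'⟩ := hA.exchange hB (e := a) (by simpa using ha)
    have hxB : x ∈ B := by simpa using hx.1
    have hxA : x ∉ A := by simpa using hx.2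
    have hA'' : M.IsBase (insert x (A.erase a) : Finset E) := by
      rw [Finset.coe_insert, Finset.coe_erase]
      exact hA'
    have hcard : (insert x (A.erase a) \ B).card = n := by
      rw [Finset.insert_sdiff_of_mem _ hxB, Finset.erase_sdiff_comm,
        Finset.card_erase_of_mem (Finset.mem_sdiff.2 ha), hn, Nat.add_sub_cancel]
    have hxa : x ∉ A.erase a := fun h => hxA (Finset.mem_of_mem_erase h)
    have e : insert a ((insert x (A.erase a)).erase x) = A := by
      rw [Finset.erase_insert hxa, Finset.insert_erase ha.1]
    have := h.rowPairing_exchange (I := I) (w := w) (b := x) (x := a) hA''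
      (Finset.mem_insert_self _ _) (by rwa [e]) (ih _ hcard hA'')
    rwa [e] at this

/-- A matroid whose three-term Plücker relations hold modulo two satisfies all Plücker relations
modulo two. -/
lemma ThreeTermMod2.pluckerMod2 {M : Matroid E} (h : ThreeTermMod2 M) : PluckerMod2 M := by
  -- A nonzero summand at `i` provides two bases, I - i and J ∪ {i}. The Plücker sum is the pairing
  -- of x ↦ [I - x is a basis] with the row of `i` at J ∪ {i}, so it suffices to check orthogonality
  -- at I - i.
  intro J I hJ hI
  by_contra hsum
  obtain ⟨i, hi, hne⟩ := Finset.exists_ne_zero_of_sum_ne_zero hsum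
  have hB := isBase_of_baseInd_ne_zero (left_ne_zero_of_mul hne)
  have hA := isBase_of_baseInd_ne_zero (right_ne_zero_of_mul hne)
  have hiJ : i ∉ J := by
    intro hiJ
    have := card_of_isBase hA
    rw [Finset.insert_eq_of_mem hiJ] at this
    omega
  apply hsum
  have key := h.rowPairing_eq_zero (I := I) (w := fun x => baseInd M (I.erase x)) hB ?_ _ _ rfl hA i
    (Finset.mem_insert_self _ _)
  · rwa [Finset.erase_insert hiJ] at key
  intro y hy
  have hyi := Finset.ne_of_mem_erase hy
  have hyI := Finset.mem_of_mem_erase hy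
  have e : I.erase y = insert i ((I.erase i).erase y) := by
    rw [Finset.erase_right_comm, Finset.insert_erase (Finset.mem_erase.2 ⟨hyi.symm, hi⟩)]
  -- Only x = i and x = y contribute, and both terms equal the indicator of I - y; for every other x
  -- the completed set is too small.
  rw [rowPairing, ← Finset.add_sum_erase _ _ hi, ← Finset.add_sum_erase _ _ hy,
    Finset.sum_eq_zero, add_zero, ← e, Finset.insert_erase hy, mul_comm, CharTwo.add_self_eq_zero]
  intro x hx
  rw [baseInd_of_card_ne (B := insert x _), mul_zero]
  rw [Finset.insert_eq_of_mem hx, ← card_of_isBase hB, Finset.card_erase_of_mem hy]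
  have := Finset.card_pos.2 ⟨y, hy⟩
  omega

end BinaryFoundation

/-! ### Quotients of ordered blueprints -/

namespace OrdBlpr

section Quotients

variable {B : OrdBlpr.{u}} {C : OrdBlpr.{v}} {S : B.Amb → B.Amb → Prop}

/-- A monotone homomorphism that respects the relations `S` respects the generated preorder. -/
lemma GenLE.map_le {x y : B.Amb} (h : GenLE B S x y) (f : B.Amb →+* C.Amb)
    (hf : ∀ x y, x ≤ y → f x ≤ f y) (hS : ∀ x y, S x y → f x ≤ f y) : f x ≤ f y := by
  induction h with
  | of_le h => exact hf _ _ h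
  | of_rel h => exact hS _ _ h
  | trans _ _ h h' => exact h.trans h'
  | add _ _ h h' => rw [map_add, map_add]; exact C.add_le_add' _ _ _ _ h h'
  | mul _ _ h h' => rw [map_mul, map_mul]; exact C.mul_le_mul' _ _ _ _ h h'

/-- The quotient homomorphism. -/
def quotMk (B : OrdBlpr.{u}) (S : B.Amb → B.Amb → Prop) : B.Amb →+* (B.quot S).Amb :=
  (genCon B S).mk'

lemma quotMk_surjective : Function.Surjective (quotMk B S) := (genCon B S).mk'_surjective

lemma quotMk_le_iff {x y : B.Amb} : quotMk B S x ≤ quotMk B S y ↔ GenLE B S x y := Iff.rfl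

lemma quotMk_mono {x y : B.Amb} (h : x ≤ y) : quotMk B S x ≤ quotMk B S y :=
  quotMk_le_iff.2 (.of_le h)

lemma quotMk_le_of_rel {x y : B.Amb} (h : S x y) : quotMk B S x ≤ quotMk B S y :=
  quotMk_le_iff.2 (.of_rel h)

lemma mem_quot_mon {x : (B.quot S).Amb} : x ∈ (B.quot S).mon ↔ ∃ y ∈ B.mon, quotMk B S y = x :=
  Iff.rfl

/-- The homomorphism from a quotient induced by a monotone homomorphism that respects the
relations. -/
def quotLift (f : B.Amb →+* C.Amb) (hf : ∀ x y, x ≤ y → f x ≤ f y)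
    (hS : ∀ x y, S x y → f x ≤ f y) : (B.quot S).Amb →+* C.Amb :=
  (genCon B S).lift f fun _ _ h => le_antisymm (h.1.map_le f hf hS) (h.2.map_le f hf hS)

lemma quotLift_mono (f : B.Amb →+* C.Amb) (hf : ∀ x y, x ≤ y → f x ≤ f y)
    (hS : ∀ x y, S x y → f x ≤ f y) {x y : (B.quot S).Amb} (h : x ≤ y) :
    quotLift f hf hS x ≤ quotLift f hf hS y := by
  obtain ⟨x, rfl⟩ := quotMk_surjective x
  obtain ⟨y, rfl⟩ := quotMk_surjective y
  exact (quotMk_le_iff.1 h).map_le f hf hS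

/-- A homomorphism that induces the generated preorder and that maps onto the underlying monoid
identifies its target with the quotient. -/
lemma isIso_quot (f : B.Amb →+* C.Amb) (hle : ∀ x y, f x ≤ f y ↔ GenLE B S x y)
    (hmon : ∀ y, y ∈ C.mon ↔ ∃ x ∈ B.mon, f x = y) : C.IsIso (B.quot S) := by
  let g : (B.quot S).Amb →+* C.Amb := quotLift f (fun x y h => (hle x y).2 (.of_le h))
    fun x y h => (hle x y).2 (.of_rel h)
  have hg (x : B.Amb) : g (quotMk B S x) = f x := rfl
  have hgle (x y : (B.quot S).Amb) : g x ≤ g y ↔ x ≤ y := by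
    obtain ⟨x, rfl⟩ := quotMk_surjective x
    obtain ⟨y, rfl⟩ := quotMk_surjective y
    exact hle x y
  have hinj : Function.Injective g := fun x y h =>
    le_antisymm ((hgle _ _).1 h.le) ((hgle _ _).1 h.ge)
  have hsurj : Function.Surjective g := by
    -- The range is a subsemiring containing the underlying monoid, which generates the target.
    rw [← RingHom.rangeS_eq_top, eq_top_iff, ← C.closure_eq_top, Subsemiring.closure_le]
    intro y hy
    obtain ⟨x, -, rfl⟩ := (hmon y).1 hy
    exact ⟨quotMk B S x, rfl⟩
  let e := RingEquiv.ofBijective g ⟨hinj, hsurj⟩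
  have he (x : (B.quot S).Amb) : e x = g x := rfl
  refine ⟨e.symm, fun x y => ?_, fun x => ?_⟩
  · rw [← hgle, ← he, ← he, e.apply_symm_apply, e.apply_symm_apply]
  · rw [mem_quot_mon, hmon]
    constructor
    · rintro ⟨y, hy, h⟩
      exact ⟨y, hy, by rw [← hg, h, ← he, e.apply_symm_apply]⟩
    · rintro ⟨y, hy, h⟩
      exact ⟨y, hy, by rw [← h, ← hg, ← he, e.symm_apply_apply]⟩

end Quotients

/-! ### Parities, and the order of `F2` -/

/-- The two-element field with the trivial order. -/
def zmodTwo : OrdBlpr.{0} where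
  Amb := ZMod 2
  semiring := inferInstance
  order :=
    { le := fun x y => x = y
      le_refl := fun _ => rfl
      le_trans := fun _ _ _ h h' => h.trans h'
      le_antisymm := fun _ _ h _ => h }
  add_le_add' := fun _ _ _ _ h h' => congrArg₂ (· + ·) h h'
  mul_le_mul' := fun _ _ _ _ h h' => congrArg₂ (· * ·) h h'
  mon := ⊤
  zero_mem' := trivial
  closure_eq_top := by
    rw [eq_top_iff]
    exact fun x _ => Subsemiring.subset_closure trivial

/-- An ordered blueprint has a parity if it has a homomorphism to the integers modulo two that is
constant along the order and that vanishes at no nonzero element of the underlying monoid. -/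
def HasParity (B : OrdBlpr.{u}) : Prop :=
  ∃ p : B.Amb →+* ZMod 2, (∀ x y, x ≤ y → p x = p y) ∧ ∀ x ∈ B.mon, p x = 0 → x = 0

lemma IsIso.hasParity {B : OrdBlpr.{u}} {C : OrdBlpr.{v}} (h : B.IsIso C) (hC : C.HasParity) :
    B.HasParity := by
  obtain ⟨f, hle, hmon⟩ := h
  obtain ⟨p, hp, hp'⟩ := hC
  refine ⟨p.comp f.toRingHom, fun x y hxy => hp _ _ ((hle x y).2 hxy), fun x hx h => ?_⟩
  have := hp' (f x) ((hmon x).2 hx) h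
  rwa [map_eq_zero_iff f f.injective] at this

/-- Multiply 0 ≤ z by `y` and add `x`. This produces the inequalities needed in `F2` and `F1pm`. -/
lemma genLE_add_mul {G : Type u} [CommGroup G] {S : MonoidAlgebra ℕ G → MonoidAlgebra ℕ G → Prop}
    {z : MonoidAlgebra ℕ G} (h : S 0 z) (x y : MonoidAlgebra ℕ G) :
    GenLE (ofGroup G) S x (x + z * y) := by
  have h₁ : GenLE (ofGroup G) S (0 * y : MonoidAlgebra ℕ G) (z * y : MonoidAlgebra ℕ G) :=
    GenLE.mul (.of_rel h) (.of_le le_rfl)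
  have h₂ : GenLE (ofGroup G) S (x + 0 * y : MonoidAlgebra ℕ G) (x + z * y : MonoidAlgebra ℕ G) :=
    GenLE.add (.of_le le_rfl) h₁
  rwa [zero_mul, add_zero] at h₂

/-- The sum of the coefficients of an element of a monoid algebra. -/
noncomputable def mass (G : Type u) [CommGroup G] : MonoidAlgebra ℕ G →+* ℕ :=
  (MonoidAlgebra.lift ℕ ℕ G 1).toRingHom

@[simp] lemma mass_single {G : Type u} [CommGroup G] (g : G) (n : ℕ) :
    mass G (MonoidAlgebra.single g n) = n := by
  change MonoidAlgebra.lift ℕ ℕ G 1 (MonoidAlgebra.single g n) = n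
  simp

/-- The sum of the coefficients modulo two of an element of a monoid algebra. -/
noncomputable def massMod (G : Type u) [CommGroup G] : (ofGroup G).Amb →+* zmodTwo.Amb :=
  (Nat.castRingHom (ZMod 2)).comp (mass G)

lemma massMod_apply {G : Type u} [CommGroup G] (x : MonoidAlgebra ℕ G) :
    massMod G x = ((mass G x : ℕ) : ZMod 2) := rfl

/-- The mass modulo two descends to the quotient, and a nonzero element of the monoid is the class
of a monomial, of mass one. -/
lemma hasParity_quot_ofGroup {G : Type u} [CommGroup G]
    {S : MonoidAlgebra ℕ G → MonoidAlgebra ℕ G → Prop}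
    (hS : ∀ x y, S x y → massMod G x = massMod G y) : ((ofGroup G).quot S).HasParity := by
  refine ⟨quotLift (C := zmodTwo) (massMod G) (fun x y h => congrArg (massMod G) h) hS,
    fun x y h => quotLift_mono (C := zmodTwo) _ _ _ h, ?_⟩
  rintro _ ⟨x, rfl | ⟨g, rfl⟩, rfl⟩ h
  · rfl
  · have : massMod G (MonoidAlgebra.single g 1) = (0 : ZMod 2) := h
    rw [massMod_apply, mass_single, Nat.cast_one] at this
    exact absurd this (one_ne_zero (α := ZMod 2))

lemma hasParity_F1pm : F1pm.HasParity := by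
  apply hasParity_quot_ofGroup
  rintro x y ⟨rfl, rfl⟩
  rw [massMod_apply, massMod_apply, map_zero, map_add, map_one, mass_single]
  rfl

lemma F2_rel {x y : MonoidAlgebra ℕ Unit} (h : x = 0 ∧ y = 1 + 1) :
    massMod Unit x = massMod Unit y := by
  obtain ⟨rfl, rfl⟩ := h
  rw [massMod_apply, massMod_apply, map_zero, map_add, map_one]
  rfl

lemma hasParity_F2 : F2.HasParity := hasParity_quot_ofGroup fun _ _ => F2_rel

lemma eq_mass_of_unit (x : MonoidAlgebra ℕ Unit) : x = (mass Unit x : MonoidAlgebra ℕ Unit) := by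
  induction x using MonoidAlgebra.induction_on with
  | of g =>
    rw [MonoidAlgebra.of_apply, mass_single, Nat.cast_one]
    rfl
  | add x y hx hy => rw [map_add, Nat.cast_add, ← hx, ← hy]
  | smul n x hx => rw [map_nsmul, smul_eq_mul, Nat.cast_mul, ← hx, nsmul_eq_mul]

/-- The homomorphism from `F₂` to the integers modulo two. -/
noncomputable def F2.parity : F2.Amb →+* ZMod 2 :=
  quotLift (C := zmodTwo) (massMod Unit) (fun _ _ h => congrArg (massMod Unit) h) fun _ _ => F2_rel

/-- The parity is constant along the order; conversely, ℕ[Unit] is ℕ, and an even number is a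
multiple of 1 + 1. -/
lemma F2.nonneg_iff {z : F2.Amb} : 0 ≤ z ↔ F2.parity z = 0 := by
  constructor
  · intro h
    have : F2.parity 0 = F2.parity z := quotLift_mono (C := zmodTwo) _ _ _ h
    rw [← this, map_zero]
  · intro h
    obtain ⟨x, rfl⟩ := quotMk_surjective z
    change MonoidAlgebra ℕ Unit at x
    have h : ((mass Unit x : ℕ) : ZMod 2) = 0 := h
    rw [ZMod.natCast_eq_zero_iff] at h
    obtain ⟨k, hk⟩ := h
    have hx : x = 0 + (1 + 1) * (k : MonoidAlgebra ℕ Unit) := by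
      conv_lhs => rw [eq_mass_of_unit x, hk]
      push_cast
      ring
    rw [hx]
    exact genLE_add_mul (G := Unit) ⟨rfl, rfl⟩ 0 k

lemma F2.eq_of_mem_mon {z : F2.Amb} (hz : z ∈ F2.mon) : z = 0 ∨ z = 1 := by
  obtain ⟨x, rfl | ⟨g, rfl⟩, rfl⟩ := hz
  · exact Or.inl rfl
  · exact Or.inr rfl

lemma F2.parity_of_isEps {e : F2.Amb} (he : F2.IsEps e) : F2.parity e = 1 := by
  have := F2.nonneg_iff.1 he.2
  rw [map_add, map_one] at this
  rw [← sub_eq_zero, ← this, sub_eq_add_neg, CharTwo.neg_eq, add_comm]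

lemma F2.isEps_one : F2.IsEps 1 :=
  ⟨one_mem _, F2.nonneg_iff.2 (by rw [map_add, map_one]; rfl)⟩

end OrdBlpr

/-! ### Representability over `F2` as a condition modulo two -/

namespace BinaryFoundation

open OrdBlpr

variable {E : Type u}

/-- The monoid of `F2` is {0, 1}, so the support leaves no freedom in `D`. -/
lemma parity_eq_baseInd {M : Matroid E} {D : Finset E → F2.Amb} (hD : ∀ B, D B ∈ F2.mon)
    (hD' : ∀ B : Finset E, D B ≠ 0 ↔ M.IsBase (B : Set E)) (B : Finset E) :
    F2.parity (D B) = baseInd M B := by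
  by_cases hB : M.IsBase (B : Set E)
  · rw [baseInd_of_isBase hB, (F2.eq_of_mem_mon (hD B)).resolve_left ((hD' B).2 hB), map_one]
  · rw [baseInd, if_neg hB, not_not.1 (mt (hD' B).1 hB), map_zero]

open Classical in
/-- The basis indicator with values in `F₂`. -/
noncomputable def baseIndF2 (M : Matroid E) (B : Finset E) : F2.Amb :=
  if M.IsBase (B : Set E) then 1 else 0

lemma baseIndF2_mem (M : Matroid E) (B : Finset E) : baseIndF2 M B ∈ F2.mon := by
  unfold baseIndF2
  split_ifs
  · exact one_mem _
  · exact F2.zero_mem'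

lemma baseIndF2_ne_zero (M : Matroid E) (B : Finset E) :
    baseIndF2 M B ≠ 0 ↔ M.IsBase (B : Set E) := by
  have : (1 : F2.Amb) ≠ 0 := by
    intro h
    have := congrArg F2.parity h
    rw [map_one, map_zero] at this
    exact one_ne_zero this
  unfold baseIndF2
  split_ifs with h <;> simp [h, this]

variable [LinearOrder E]

lemma map_threeTerm {R S : Type*} [CommSemiring R] [CommSemiring S] (f : R →+* S) (e : R)
    (D : Finset E → R) (I : Finset E) (i₁ i₂ i₃ i₄ : E) :
    f (threeTerm e D I i₁ i₂ i₃ i₄) = threeTerm (f e) (fun B => f (D B)) I i₁ i₂ i₃ i₄ := by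
  simp only [threeTerm, map_add, map_mul]

lemma weaklyRepresentable_F2_iff {M : Matroid E} :
    WeaklyRepresentable M F2 ↔ ThreeTermMod2 M := by
  have key {e : F2.Amb} (he : F2.IsEps e) {D : Finset E → F2.Amb} (hD : ∀ B, D B ∈ F2.mon)
      (hD' : ∀ B : Finset E, D B ≠ 0 ↔ M.IsBase (B : Set E)) (I : Finset E) (i₁ i₂ i₃ i₄ : E) :
      0 ≤ threeTerm e D I i₁ i₂ i₃ i₄ ↔ threeTerm 1 (baseInd M) I i₁ i₂ i₃ i₄ = 0 := by
    rw [F2.nonneg_iff, map_threeTerm, F2.parity_of_isEps he]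
    simp_rw [parity_eq_baseInd hD hD']
  constructor
  · rintro ⟨e, he, D, hD, hD', h⟩ I i₁ i₂ i₃ i₄ hI
    exact (key he hD hD' _ _ _ _ _).1 (h I i₁ i₂ i₃ i₄ hI)
  · intro h
    exact ⟨1, F2.isEps_one, baseIndF2 M, baseIndF2_mem M, baseIndF2_ne_zero M,
      fun I i₁ i₂ i₃ i₄ hI => (key F2.isEps_one (baseIndF2_mem M) (baseIndF2_ne_zero M)
        _ _ _ _ _).2 (h I i₁ i₂ i₃ i₄ hI)⟩

lemma stronglyRepresentable_F2_iff {M : Matroid E} :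
    StronglyRepresentable M F2 ↔ PluckerMod2 M := by
  have key {e : F2.Amb} (he : F2.IsEps e) {D : Finset E → F2.Amb} (hD : ∀ B, D B ∈ F2.mon)
      (hD' : ∀ B : Finset E, D B ≠ 0 ↔ M.IsBase (B : Set E)) (J I : Finset E)
      (hJ : J.card + 1 = rk M) (hI : I.card = rk M + 1) :
      (0 ≤ ∑ k : Fin (rk M + 1),
        if I.orderEmbOfFin hI k ∈ J then 0
        else e ^ (k : ℕ) * (D (I.erase (I.orderEmbOfFin hI k)) *
          D (insert (I.orderEmbOfFin hI k) J))) ↔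
        ∑ i ∈ I, baseInd M (I.erase i) * baseInd M (insert i J) = 0 := by
    have hsum : ∑ i ∈ I, baseInd M (I.erase i) * baseInd M (insert i J) =
        ∑ k : Fin (rk M + 1), baseInd M (I.erase (I.orderEmbOfFin hI k)) *
          baseInd M (insert (I.orderEmbOfFin hI k) J) := by
      conv_lhs => rw [← Finset.map_orderEmbOfFin_univ I hI]
      rw [Finset.sum_map, Finset.map_orderEmbOfFin_univ]
      rfl
    rw [F2.nonneg_iff, map_sum, hsum]
    refine Eq.congr_left (Finset.sum_congr rfl fun k _ => ?_)
    split_ifs with hk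
    -- The convention that the term is 0 for an index in `J` agrees with the indicator, as `J` has
    -- one element too few to be a basis.
    · rw [Finset.insert_eq_of_mem hk, baseInd_of_card_ne (B := J) (by omega), map_zero, mul_zero]
    · rw [map_mul, map_mul, map_pow, F2.parity_of_isEps he, one_pow, one_mul,
        parity_eq_baseInd hD hD', parity_eq_baseInd hD hD']
  constructor
  · rintro ⟨e, he, D, hD, hD', h⟩ J I hJ hI
    exact (key he hD hD' _ _ hJ hI).1 (h J I hJ hI)
  · intro h
    exact ⟨1, F2.isEps_one, baseIndF2 M, baseIndF2_mem M, baseIndF2_ne_zero M,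
      fun J I hJ hI => (key F2.isEps_one (baseIndF2_mem M) (baseIndF2_ne_zero M)
        _ _ hJ hI).2 (h J I hJ hI)⟩

end BinaryFoundation

/-! ### Monomials of degree zero and their classes -/

namespace OrdBlpr

lemma mul_nonneg_of_nonneg {B : OrdBlpr.{u}} {x : B.Amb} (y : B.Amb) (h : 0 ≤ x) : 0 ≤ y * x := by
  have := B.mul_le_mul' y y 0 x le_rfl h
  rwa [mul_zero] at this

/-- A fundamental element, as an element of the foundation. -/
def IsFundamental.toFound {B : OrdBlpr.{u}} {a : B.Amb} (h : B.IsFundamental a) : B.found.Amb :=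
  ⟨a, Subsemiring.subset_closure (Submonoid.subset_closure (Or.inr h))⟩

lemma IsFundamental.toFound_mem {B : OrdBlpr.{u}} {a : B.Amb} (h : B.IsFundamental a) :
    h.toFound ∈ B.found.mon := Submonoid.subset_closure (Or.inr h)

end OrdBlpr

namespace BinaryFoundation

open OrdBlpr

variable {E : Type u}

lemma deg_mul {M : Matroid E} (g h : Mono M) : deg (g * h) = deg g + deg h :=
  Finsupp.sum_add_index' (fun _ => rfl) fun _ _ _ => rfl

lemma deg_one {M : Matroid E} : deg (1 : Mono M) = 0 := Finsupp.sum_zero_index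

lemma deg_inv {M : Matroid E} (g : Mono M) : deg g⁻¹ = -deg g := by
  have := deg_mul g⁻¹ g
  rw [inv_mul_cancel, deg_one] at this
  omega

/-- The group of Laurent monomials of degree zero. -/
def degreeZero (M : Matroid E) : Subgroup (Mono M) where
  carrier := {g | deg g = 0}
  one_mem' := deg_one
  mul_mem' {g h} hg hh := by
    change deg (g * h) = 0
    rw [deg_mul, hg, hh, add_zero]
  inv_mem' {g} hg := by
    change deg g⁻¹ = 0
    rw [deg_inv, hg, neg_zero]

/-- The monomial `ε`. -/
def epsMono (M : Matroid E) : Mono M := (-1, 1)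

lemma epsMono_mul_self (M : Matroid E) : epsMono M * epsMono M = 1 :=
  Prod.ext (by simp [epsMono]) (by simp [epsMono])

lemma deg_epsMono (M : Matroid E) : deg (epsMono M) = 0 := Finsupp.sum_zero_index

/-- The monomial `ε` as a monomial of degree zero. -/
def epsZero (M : Matroid E) : degreeZero M := ⟨epsMono M, deg_epsMono M⟩

/-- `t` is zero or a monomial of degree `n`, according to whether `c` is zero or one. -/
def IsTerm {M : Matroid E} (n : ℤ) (t : MonoidAlgebra ℕ (Mono M)) (c : ZMod 2) : Prop :=
  (t = 0 ∧ c = 0) ∨ ∃ g : Mono M, deg g = n ∧ t = MonoidAlgebra.single g 1 ∧ c = 1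

lemma isTerm_coord (M : Matroid E) (B : Finset E) : IsTerm 1 (coord M B) (baseInd M B) := by
  by_cases h : M.IsBase (B : Set E)
  · refine Or.inr ⟨_, ?_, dif_pos h, baseInd_of_isBase h⟩
    exact Finsupp.sum_single_index rfl
  · exact Or.inl ⟨dif_neg h, if_neg h⟩

lemma IsTerm.mul {M : Matroid E} {m n : ℤ} {s t : MonoidAlgebra ℕ (Mono M)} {c d : ZMod 2}
    (hs : IsTerm m s c) (ht : IsTerm n t d) : IsTerm (m + n) (s * t) (c * d) := by
  rcases hs with ⟨rfl, rfl⟩ | ⟨g, hg, rfl, rfl⟩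
  · exact Or.inl ⟨zero_mul _, zero_mul _⟩
  rcases ht with ⟨rfl, rfl⟩ | ⟨h, hh, rfl, rfl⟩
  · exact Or.inl ⟨mul_zero _, mul_zero _⟩
  · refine Or.inr ⟨g * h, by rw [deg_mul, hg, hh], ?_, mul_one _⟩
    rw [MonoidAlgebra.single_mul_single, mul_one]

lemma isTerm_eps (M : Matroid E) : IsTerm 0 (eps M) 1 :=
  Or.inr ⟨_, deg_epsMono M, rfl, rfl⟩

lemma single_inv_mul {M : Matroid E} (g h : Mono M) :
    (MonoidAlgebra.single g⁻¹ 1 * MonoidAlgebra.single h 1 : MonoidAlgebra ℕ (Mono M)) =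
      MonoidAlgebra.single (g⁻¹ * h) 1 := by
  rw [MonoidAlgebra.single_mul_single, mul_one]

lemma inv_mul_mem_degreeZero {M : Matroid E} {g h : Mono M} {n : ℤ} (hg : deg g = n)
    (hh : deg h = n) : g⁻¹ * h ∈ degreeZero M := by
  change deg (g⁻¹ * h) = 0
  rw [deg_mul, deg_inv, hg, hh, neg_add_cancel]

variable [LinearOrder E]

/-- Tracks simultaneously which terms survive as monomials and modulo two. The common degree 2
ensures that quotients of surviving terms have degree zero. -/
lemma exists_isTerm_threeTerm (M : Matroid E) (I : Finset E) (i₁ i₂ i₃ i₄ : E) :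
    ∃ t₁ t₂ t₃ c₁ c₂ c₃, threeTerm (eps M) (coord M) I i₁ i₂ i₃ i₄ = t₁ + t₂ + t₃ ∧
      threeTerm 1 (baseInd M) I i₁ i₂ i₃ i₄ = c₁ + c₂ + c₃ ∧
      IsTerm 2 t₁ c₁ ∧ IsTerm 2 t₂ c₂ ∧ IsTerm 2 t₃ c₃ :=
  ⟨_, _, _, _, _, _, rfl, rfl, (isTerm_coord M _).mul (isTerm_coord M _),
    (isTerm_eps M).mul ((isTerm_coord M _).mul (isTerm_coord M _)),
    (isTerm_coord M _).mul (isTerm_coord M _)⟩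

/-- The projection of the Laurent polynomials onto `coordBlpr M`. -/
noncomputable def coordMk (M : Matroid E) : MonoidAlgebra ℕ (Mono M) →+* (coordBlpr M).Amb :=
  quotMk (ofGroup (Mono M)) _

/-- The projection of the degree-zero part onto the weak universal pasture. -/
noncomputable def residueMk (M : Matroid E) :
    (weakResidue M).Amb →+* (weakUniversalPasture M).Amb :=
  quotMk (weakResidue M) _

/-- The monomials of degree zero in the degree-zero part. -/
noncomputable def residueMono (M : Matroid E) : degreeZero M →* (weakResidue M).Amb where
  toFun g := ⟨coordMk M (MonoidAlgebra.single g 1),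
    Subsemiring.subset_closure (Submonoid.subset_closure (Or.inr ⟨g, g.2, rfl⟩))⟩
  map_one' := rfl
  map_mul' g h := by
    apply Subtype.ext
    change coordMk M (MonoidAlgebra.single ((g : Mono M) * h) 1) =
      coordMk M (MonoidAlgebra.single (g : Mono M) 1) * coordMk M (MonoidAlgebra.single (h : Mono M) 1)
    rw [← map_mul, MonoidAlgebra.single_mul_single, mul_one]

lemma residueMono_mem (M : Matroid E) (g : degreeZero M) :
    residueMono M g ∈ (weakResidue M).mon :=
  Submonoid.subset_closure (Or.inr ⟨g, g.2, rfl⟩)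

lemma mem_weakResidue_mon {M : Matroid E} {x : (weakResidue M).Amb}
    (hx : x ∈ (weakResidue M).mon) : x = 0 ∨ ∃ g, x = residueMono M g := by
  have key : ∀ y ∈ Submonoid.closure
      (insert 0 {a | ∃ g : Mono M, deg g = 0 ∧ a = coordBlpr.monomial M g}),
      y = 0 ∨ ∃ g, y = (residueMono M g : (weakResidue M).Amb).1 := by
    intro y hy
    induction hy using Submonoid.closure_induction with
    | mem y hy =>
      rcases hy with rfl | ⟨g, hg, rfl⟩
      · exact Or.inl rfl
      · exact Or.inr ⟨⟨g, hg⟩, rfl⟩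
    | one => exact Or.inr ⟨1, rfl⟩
    | mul y z _ _ hy hz =>
      rcases hy with rfl | ⟨g, rfl⟩
      · exact Or.inl (zero_mul _)
      rcases hz with rfl | ⟨h, rfl⟩
      · exact Or.inl (mul_zero _)
      · exact Or.inr ⟨g * h, by rw [map_mul]; rfl⟩
  rcases key x.1 hx with h | ⟨g, h⟩
  · exact Or.inl (Subtype.ext h)
  · exact Or.inr ⟨g, Subtype.ext h⟩

/-- The classes of the monomials of degree zero in the weak universal pasture. -/
noncomputable def cls (M : Matroid E) : degreeZero M →* (weakUniversalPasture M).Amb :=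
  (residueMk M).toMonoidHom.comp (residueMono M)

lemma cls_mem (M : Matroid E) (g : degreeZero M) : cls M g ∈ (weakUniversalPasture M).mon :=
  mem_quot_mon.2 ⟨_, residueMono_mem M g, rfl⟩

lemma mem_weakUniversalPasture_mon {M : Matroid E} {x : (weakUniversalPasture M).Amb}
    (hx : x ∈ (weakUniversalPasture M).mon) : x = 0 ∨ ∃ g, x = cls M g := by
  obtain ⟨y, hy, rfl⟩ := mem_quot_mon.1 hx
  rcases mem_weakResidue_mon hy with rfl | ⟨g, rfl⟩
  · exact Or.inl (map_zero (residueMk M))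
  · exact Or.inr ⟨g, rfl⟩

lemma residueMk_nonneg {M : Matroid E} {x : (weakResidue M).Amb}
    (h : (0 : (coordBlpr M).Amb) ≤ x.1) : 0 ≤ residueMk M x :=
  quotMk_mono h

lemma coordMk_eps_nonneg (M : Matroid E) : 0 ≤ coordMk M (1 + eps M) :=
  quotMk_le_of_rel (B := ofGroup (Mono M)) ⟨rfl, Or.inl rfl⟩

lemma coordMk_threeTerm_nonneg {M : Matroid E} {I : Finset E} {i₁ i₂ i₃ i₄ : E}
    (h : IsIndex (rk M) I i₁ i₂ i₃ i₄) :
    0 ≤ coordMk M (threeTerm (eps M) (coord M) I i₁ i₂ i₃ i₄) :=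
  quotMk_le_of_rel (B := ofGroup (Mono M)) ⟨rfl, Or.inr ⟨I, i₁, i₂, i₃, i₄, h, rfl⟩⟩

lemma one_add_residueMono_eps_nonneg (M : Matroid E) : 0 ≤ 1 + residueMono M (epsZero M) :=
  coordMk_eps_nonneg M

lemma one_add_cls_eps_nonneg (M : Matroid E) : 0 ≤ 1 + cls M (epsZero M) :=
  residueMk_nonneg (x := 1 + residueMono M (epsZero M)) (one_add_residueMono_eps_nonneg M)

lemma isEps_cls_eps (M : Matroid E) : (weakUniversalPasture M).IsEps (cls M (epsZero M)) :=
  ⟨cls_mem M _, one_add_cls_eps_nonneg M⟩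

lemma isFundamental_of_nonneg {M : Matroid E} {g h : degreeZero M}
    (H : 0 ≤ cls M g + cls M h + 1) : (weakUniversalPasture M).IsFundamental (cls M g) :=
  ⟨cls_mem M g, cls M h, cls_mem M h, cls M (epsZero M), isEps_cls_eps M, 0, by
    rw [Fin.val_zero, pow_zero]; exact H⟩

/-! ### A parity of the foundation forces the relations modulo two -/

lemma one_ne_zero_of_hasParity {M : Matroid E} (h : (foundation M).HasParity) :
    (1 : (weakUniversalPasture M).Amb) ≠ 0 := by
  obtain ⟨p, -, -⟩ := h
  intro h
  have : (1 : (foundation M).Amb) = 0 := Subtype.ext h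
  have := congrArg p this
  rw [map_one, map_zero] at this
  exact one_ne_zero this

lemma not_zero_le_one_of_hasParity {M : Matroid E} (h : (foundation M).HasParity) :
    ¬ (0 : (weakUniversalPasture M).Amb) ≤ 1 := by
  obtain ⟨p, hp, -⟩ := h
  intro h
  have := hp 0 1 h
  rw [map_one, map_zero] at this
  exact zero_ne_one this

lemma cls_ne_zero {M : Matroid E} (h : (1 : (weakUniversalPasture M).Amb) ≠ 0) (g : degreeZero M) :
    cls M g ≠ 0 := by
  intro hg
  apply h
  rw [← map_one (cls M), ← mul_inv_cancel g, map_mul, hg, zero_mul]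

/-- Such a relation makes both classes fundamental, so it already holds in the foundation. Both are
nonzero, being invertible, so each has parity 1, and 1 + 1 + 1 is odd. -/
lemma not_nonneg_three_of_hasParity {M : Matroid E} (H : (foundation M).HasParity)
    (g h : degreeZero M) : ¬ 0 ≤ cls M g + cls M h + 1 := by
  intro hle
  have hg := isFundamental_of_nonneg hle
  have hh : (weakUniversalPasture M).IsFundamental (cls M h) :=
    isFundamental_of_nonneg (h := g) (by rwa [add_comm (cls M h)])
  have h1 := one_ne_zero_of_hasParity H
  obtain ⟨p, hp, hp'⟩ := H
  let a : (foundation M).Amb := hg.toFound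
  let b : (foundation M).Amb := hh.toFound
  have hle' : 0 ≤ a + b + 1 := hle
  have key := hp _ _ hle'
  rw [map_zero, map_add, map_add, map_one] at key
  have hpg : p a ≠ 0 := fun h =>
    cls_ne_zero h1 g (congrArg Subtype.val (hp' _ hg.toFound_mem h))
  have hph : p b ≠ 0 := fun h' =>
    cls_ne_zero h1 h (congrArg Subtype.val (hp' _ hh.toFound_mem h'))
  have one_of_ne : ∀ c : ZMod 2, c ≠ 0 → c = 1 := by decide
  rw [one_of_ne _ hpg, one_of_ne _ hph] at key
  exact absurd key (by decide)

/-- Division by a monomial. -/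
lemma coordMk_div_nonneg {M : Matroid E} {x : MonoidAlgebra ℕ (Mono M)} (g : Mono M)
    (h : 0 ≤ coordMk M x) : 0 ≤ coordMk M (MonoidAlgebra.single g⁻¹ 1 * x) := by
  rw [map_mul]
  exact mul_nonneg_of_nonneg _ h

lemma not_nonneg_single_of_hasParity {M : Matroid E} (H : (foundation M).HasParity) (g : Mono M) :
    ¬ 0 ≤ coordMk M (MonoidAlgebra.single g 1) := by
  intro h
  have := coordMk_div_nonneg g h
  rw [single_inv_mul, inv_mul_cancel] at this
  exact not_zero_le_one_of_hasParity H (residueMk_nonneg (M := M) (x := 1) this)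

lemma not_nonneg_sum_of_hasParity {M : Matroid E} (H : (foundation M).HasParity)
    {g₁ g₂ g₃ : Mono M} {n : ℤ} (h₁ : deg g₁ = n) (h₂ : deg g₂ = n) (h₃ : deg g₃ = n) :
    ¬ 0 ≤ coordMk M (MonoidAlgebra.single g₁ 1 + MonoidAlgebra.single g₂ 1 +
      MonoidAlgebra.single g₃ 1) := by
  intro h
  have := coordMk_div_nonneg g₃ h
  rw [mul_add, mul_add, single_inv_mul, single_inv_mul, single_inv_mul, inv_mul_cancel] at this
  let a : degreeZero M := ⟨_, inv_mul_mem_degreeZero h₃ h₁⟩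
  let b : degreeZero M := ⟨_, inv_mul_mem_degreeZero h₃ h₂⟩
  exact not_nonneg_three_of_hasParity H a b
    (residueMk_nonneg (x := residueMono M a + residueMono M b + 1) this)

/-- If the foundation has a parity, then the three-term Plücker relations hold modulo two. -/
lemma threeTermMod2_of_hasParity {M : Matroid E} (H : (foundation M).HasParity) :
    ThreeTermMod2 M := by
  intro I i₁ i₂ i₃ i₄ hI
  have h := coordMk_threeTerm_nonneg hI
  obtain ⟨t₁, t₂, t₃, c₁, c₂, c₃, ht, hc, h₁, h₂, h₃⟩ := exists_isTerm_threeTerm M I i₁ i₂ i₃ i₄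
  rw [ht] at h
  rw [hc]
  -- Eight cases by surviving terms: an even number gives the claim, and one or three contradict the
  -- parity.
  rcases h₁ with ⟨rfl, rfl⟩ | ⟨g₁, hg₁, rfl, rfl⟩ <;>
    rcases h₂ with ⟨rfl, rfl⟩ | ⟨g₂, hg₂, rfl, rfl⟩ <;>
    rcases h₃ with ⟨rfl, rfl⟩ | ⟨g₃, hg₃, rfl, rfl⟩ <;>
    first
    | rfl
    | (simp only [zero_add, add_zero] at h
       exact absurd h (not_nonneg_single_of_hasParity H _))
    | exact absurd h (not_nonneg_sum_of_hasParity H hg₁ hg₂ hg₃)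

/-- If the three-term Plücker relations hold modulo two, then each of them has no or two nonzero
terms. -/
lemma ThreeTermMod2.threeTerm_eq {M : Matroid E} (H : ThreeTermMod2 M) {I : Finset E}
    {i₁ i₂ i₃ i₄ : E} (hI : IsIndex (rk M) I i₁ i₂ i₃ i₄) :
    threeTerm (eps M) (coord M) I i₁ i₂ i₃ i₄ = 0 ∨ ∃ g h : Mono M, deg g = 2 ∧ deg h = 2 ∧
      threeTerm (eps M) (coord M) I i₁ i₂ i₃ i₄ =
        MonoidAlgebra.single g 1 + MonoidAlgebra.single h 1 := by
  obtain ⟨t₁, t₂, t₃, c₁, c₂, c₃, ht, hc, h₁, h₂, h₃⟩ := exists_isTerm_threeTerm M I i₁ i₂ i₃ i₄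
  have h0 := H _ _ _ _ _ hI
  rw [hc] at h0
  rw [ht]
  rcases h₁ with ⟨rfl, rfl⟩ | ⟨g₁, hg₁, rfl, rfl⟩ <;>
    rcases h₂ with ⟨rfl, rfl⟩ | ⟨g₂, hg₂, rfl, rfl⟩ <;>
    rcases h₃ with ⟨rfl, rfl⟩ | ⟨g₃, hg₃, rfl, rfl⟩ <;>
    first
    | exact absurd h0 (by decide)
    | (left; simp only [add_zero]; done)
    | (right; simp only [zero_add, add_zero]; exact ⟨_, _, hg₁, hg₂, rfl⟩)
    | (right; simp only [zero_add, add_zero]; exact ⟨_, _, hg₁, hg₃, rfl⟩)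
    | (right; simp only [zero_add]; exact ⟨_, _, hg₂, hg₃, rfl⟩)

end BinaryFoundation

/-! ### Group semirings ordered by 0 ≤ 1 + e -/

namespace OrdBlpr

section SignedGroup

variable {G : Type u} [CommGroup G]

lemma coeff_one_add_single_mul (e : G) (z : MonoidAlgebra ℕ G) (g : G) :
    ((1 + MonoidAlgebra.single e 1) * z).coeff g = z.coeff g + z.coeff (e⁻¹ * g) := by
  rw [add_mul, one_mul, MonoidAlgebra.coeff_add, Finsupp.add_apply,
    MonoidAlgebra.coeff_single_mul_apply, one_mul]

/-- The group semiring `ℕ[G]` with the order generated by `0 ≤ 1 + e`. -/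
noncomputable def signedGroup (G : Type u) [CommGroup G] (e : G) : OrdBlpr.{u} where
  Amb := MonoidAlgebra ℕ G
  semiring := inferInstance
  order :=
    { le := fun x y => ∃ z, y = x + (1 + MonoidAlgebra.single e 1) * z
      le_refl := fun x => ⟨0, by rw [mul_zero, add_zero]⟩
      le_trans := by
        rintro x _ _ ⟨z, rfl⟩ ⟨t, rfl⟩
        exact ⟨z + t, by ring⟩
      le_antisymm := by
        rintro x y ⟨z, hz⟩ ⟨t, ht⟩
        -- Coefficients in ℕ can only grow along the order, so antisymmetry holds coefficientwise.
        ext g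
        have h₁ := congrArg (fun w => w.coeff g) hz
        have h₂ := congrArg (fun w => w.coeff g) ht
        simp only [MonoidAlgebra.coeff_add, Finsupp.add_apply] at h₁ h₂
        omega }
  add_le_add' := by
    rintro x _ z _ ⟨s, rfl⟩ ⟨t, rfl⟩
    exact ⟨s + t, by ring⟩
  mul_le_mul' := by
    rintro x _ z _ ⟨s, rfl⟩ ⟨t, rfl⟩
    exact ⟨x * t + s * z + (1 + MonoidAlgebra.single e 1) * s * t, by ring⟩
  mon := (ofGroup G).mon
  zero_mem' := (ofGroup G).zero_mem'
  closure_eq_top := (ofGroup G).closure_eq_top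

/-- The monomial of a group element, as an element of the signed group semiring. -/
noncomputable def signedMono (e g : G) : (signedGroup G e).Amb :=
  (MonoidAlgebra.single g 1 : MonoidAlgebra ℕ G)

lemma signedGroup_le_iff {e : G} {x y : MonoidAlgebra ℕ G} :
    @LE.le (signedGroup G e).Amb _ x y ↔ ∃ z, y = x + (1 + MonoidAlgebra.single e 1) * z := Iff.rfl

/-- Nonnegative elements are multiples of 1 + e and have even mass. -/
lemma not_nonneg_signedMono (e g : G) : ¬ 0 ≤ signedMono e g := by
  rintro ⟨z, hz⟩
  have hz : (MonoidAlgebra.single g 1 : MonoidAlgebra ℕ G) =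
    0 + (1 + MonoidAlgebra.single e 1) * z := hz
  have := congrArg (mass G) hz
  rw [map_add, map_mul, map_add, mass_single, mass_single, map_one, map_zero] at this
  omega

/-- As e² = 1, a multiple of 1 + e has equal coefficients at `g` and at e g, so the monomial at e g
must come from `h`. If e g = g, the coefficient there is even, which again forces h = g. -/
lemma eq_of_signedMono_add_nonneg {e g h : G} (he : e * e = 1)
    (H : 0 ≤ signedMono e g + signedMono e h) : h = e * g := by
  obtain ⟨z, hz⟩ := H
  have hz : (MonoidAlgebra.single g 1 + MonoidAlgebra.single h 1 : MonoidAlgebra ℕ G) =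
    0 + (1 + MonoidAlgebra.single e 1) * z := hz
  rw [zero_add] at hz
  have hinv : e⁻¹ = e := inv_eq_of_mul_eq_one_left he
  have h₁ := congrArg (fun w => w.coeff g) hz
  have h₂ := congrArg (fun w => w.coeff (e * g)) hz
  simp only [coeff_one_add_single_mul, MonoidAlgebra.coeff_add, Finsupp.add_apply,
    MonoidAlgebra.coeff_single, hinv] at h₁ h₂
  rw [← mul_assoc, he, one_mul] at h₂
  by_contra hne
  rw [Finsupp.single_eq_same] at h₁
  rw [Finsupp.single_eq_of_ne (a := h) (Ne.symm hne)] at h₂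
  by_cases hg : e * g = g
  · rw [hg] at h₁ h₂ hne
    rw [Finsupp.single_eq_same] at h₂
    omega
  · rw [Finsupp.single_eq_of_ne hg] at h₂
    omega

end SignedGroup

end OrdBlpr

/-! ### Detecting the order of the weak universal pasture -/

namespace BinaryFoundation

open OrdBlpr

variable {E : Type u}

/-- The signs as monomials of degree zero. -/
def signMono (M : Matroid E) : ℤˣ →* degreeZero M where
  toFun s := ⟨(s, 1), Finsupp.sum_zero_index⟩
  map_one' := rfl
  map_mul' s t := Subtype.ext (Prod.ext rfl (by simp))

lemma signMono_neg_one (M : Matroid E) : signMono M (-1) = epsZero M := rfl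

variable [LinearOrder E]

/-- Both `g` and ε are weak inverses of 1, and pasteurization identifies them. -/
lemma cls_eq_cls_eps_of_nonneg {M : Matroid E} {g : degreeZero M} (h : 0 ≤ 1 + residueMono M g) :
    cls M g = cls M (epsZero M) := by
  have hε := one_add_residueMono_eps_nonneg M
  rw [add_comm] at h hε
  exact le_antisymm
    (quotMk_le_of_rel (B := weakResidue M)
      ⟨residueMono_mem M _, residueMono_mem M _, 1, one_mem _, h, hε⟩)
    (quotMk_le_of_rel (B := weakResidue M)
      ⟨residueMono_mem M _, residueMono_mem M _, 1, one_mem _, hε, h⟩)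

/-- The group of monomials of degree zero whose class in the weak universal pasture is one. -/
noncomputable def trivialMonomials (M : Matroid E) : Subgroup (Mono M) :=
  (cls M).ker.map (degreeZero M).subtype

/-- The group of monomials modulo those that become one in the weak universal pasture. -/
abbrev MonoQuot (M : Matroid E) : Type u := Mono M ⧸ trivialMonomials M

/-- The projection onto the group of monomials modulo trivial monomials. -/
noncomputable def monoMk (M : Matroid E) : Mono M →* MonoQuot M :=
  QuotientGroup.mk' (trivialMonomials M)

lemma monoMk_eq_iff {M : Matroid E} {g h : degreeZero M} :
    monoMk M g = monoMk M h ↔ cls M g = cls M h := by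
  have key : monoMk M g = monoMk M h ↔ cls M (g⁻¹ * h) = 1 := by
    rw [monoMk, QuotientGroup.mk'_apply, QuotientGroup.mk'_apply, QuotientGroup.eq]
    constructor
    · rintro ⟨k, hk, hk'⟩
      have : k = g⁻¹ * h := Subtype.ext hk'
      rwa [← this]
    · intro hk
      exact ⟨g⁻¹ * h, hk, rfl⟩
  rw [key, map_mul]
  constructor
  · intro H
    rw [← mul_one (cls M g), ← H, ← mul_assoc, ← map_mul, mul_inv_cancel, map_one, one_mul]
  · intro H
    rw [← H, ← map_mul, inv_mul_cancel, map_one]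

lemma monoMk_eps_mul_self (M : Matroid E) :
    monoMk M (epsMono M) * monoMk M (epsMono M) = 1 := by
  rw [← map_mul, epsMono_mul_self, map_one]

/-- The group semiring that detects the order of the weak universal pasture of a binary matroid. -/
noncomputable def detector (M : Matroid E) : OrdBlpr.{u} :=
  signedGroup (MonoQuot M) (monoMk M (epsMono M))

/-- The monomials in the detecting group semiring. -/
noncomputable def detectorMono (M : Matroid E) (g : Mono M) : (detector M).Amb :=
  signedMono (monoMk M (epsMono M)) (monoMk M g)

/-- The homomorphism from the Laurent polynomials to the detecting group semiring. -/
noncomputable def detect (M : Matroid E) : (ofGroup (Mono M)).Amb →+* (detector M).Amb :=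
  MonoidAlgebra.mapDomainRingHom ℕ (monoMk M)

lemma detect_single (M : Matroid E) (g : Mono M) :
    detect M (MonoidAlgebra.single g 1 : MonoidAlgebra ℕ (Mono M)) = detectorMono M g :=
  MonoidAlgebra.mapDomain_single

lemma detector_nonneg_pair (M : Matroid E) {g h : Mono M}
    (H : monoMk M h = monoMk M (epsMono M) * monoMk M g) :
    0 ≤ detectorMono M g + detectorMono M h := by
  refine signedGroup_le_iff.2 ⟨MonoidAlgebra.single (monoMk M g) 1, ?_⟩
  have key : (MonoidAlgebra.single (monoMk M g) 1 + MonoidAlgebra.single (monoMk M h) 1 :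
      MonoidAlgebra ℕ (MonoQuot M)) = 0 + (1 + MonoidAlgebra.single (monoMk M (epsMono M)) 1) *
        MonoidAlgebra.single (monoMk M g) 1 := by
    rw [zero_add, add_mul, one_mul, MonoidAlgebra.single_mul_single, mul_one, ← H]
  exact key

/-- Dividing by `g` gives 0 ≤ 1 + h/g in degree zero, where pasteurization forces h/g = ε. -/
lemma monoMk_of_nonneg {M : Matroid E} {g h : Mono M} {n : ℤ} (hg : deg g = n) (hh : deg h = n)
    (H : 0 ≤ coordMk M (MonoidAlgebra.single g 1 + MonoidAlgebra.single h 1)) :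
    monoMk M h = monoMk M (epsMono M) * monoMk M g := by
  have := coordMk_div_nonneg g H
  rw [mul_add, single_inv_mul, single_inv_mul, inv_mul_cancel] at this
  let a : degreeZero M := ⟨_, inv_mul_mem_degreeZero hg hh⟩
  have ha : cls M a = cls M (epsZero M) := cls_eq_cls_eps_of_nonneg this
  have := monoMk_eq_iff.2 ha
  change monoMk M (g⁻¹ * h) = monoMk M (epsMono M) at this
  rw [← this, ← map_mul, mul_comm, mul_inv_cancel_left]

/-- A nonzero three-term relation has exactly two terms; their ratio is ε in the pasture, hence in
the quotient group, so the relation becomes a multiple of 0 ≤ 1 + ε. -/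
lemma ThreeTermMod2.detect_mono {M : Matroid E} (H : ThreeTermMod2 M)
    (x y : MonoidAlgebra ℕ (Mono M))
    (h : x = 0 ∧ (y = 1 + eps M ∨ ∃ (I : Finset E) (i₁ i₂ i₃ i₄ : E),
      IsIndex (rk M) I i₁ i₂ i₃ i₄ ∧ y = threeTerm (eps M) (coord M) I i₁ i₂ i₃ i₄)) :
    detect M x ≤ detect M y := by
  have pair {g h : Mono M} (hgh : monoMk M h = monoMk M (epsMono M) * monoMk M g) :
      detect M (0 : MonoidAlgebra ℕ (Mono M)) ≤
        detect M (MonoidAlgebra.single g 1 + MonoidAlgebra.single h 1 : MonoidAlgebra ℕ (Mono M)) := by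
    have := detector_nonneg_pair M hgh
    rw [← detect_single, ← detect_single] at this
    exact (map_zero (detect M)).le.trans (this.trans (map_add (detect M) _ _).ge)
  obtain ⟨rfl, rfl | ⟨I, i₁, i₂, i₃, i₄, hI, rfl⟩⟩ := h
  · exact pair (g := 1) (h := epsMono M) (by rw [map_one, mul_one])
  · have hnonneg := coordMk_threeTerm_nonneg hI
    rcases H.threeTerm_eq hI with h | ⟨g, h, hg, hh, he⟩
    · rw [h]
    · rw [he] at hnonneg ⊢
      exact pair (monoMk_of_nonneg hg hh hnonneg)

/-- The weak universal pasture of a matroid whose three-term Plücker relations hold modulo two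
maps monotonically to the detecting group semiring. -/
lemma ThreeTermMod2.exists_hom {M : Matroid E} (H : ThreeTermMod2 M) :
    ∃ f : (weakUniversalPasture M).Amb →+* (detector M).Amb, (∀ x y, x ≤ y → f x ≤ f y) ∧
      ∀ g : degreeZero M, f (cls M g) = detectorMono M g := by
  let f₁ : (coordBlpr M).Amb →+* (detector M).Amb :=
    quotLift (detect M) (fun x y h => le_of_eq (congrArg (detect M) h)) H.detect_mono
  have hf₁ (x y : (coordBlpr M).Amb) (h : x ≤ y) : f₁ x ≤ f₁ y := quotLift_mono _ _ _ h
  let f₂ : (weakResidue M).Amb →+* (detector M).Amb := f₁.comp (Subsemiring.subtype _)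
  have hf₂ (x y : (weakResidue M).Amb) (h : x ≤ y) : f₂ x ≤ f₂ y := hf₁ _ _ h
  have hf₂' (g : degreeZero M) : f₂ (residueMono M g) = detectorMono M g := detect_single M g
  -- Weak inverses are unique after mapping to the detector, so the identifications of
  -- pasteurization are respected.
  have unique {a b : (weakResidue M).Amb} (ha : a ∈ (weakResidue M).mon)
      (hb : b ∈ (weakResidue M).mon) (hab : 0 ≤ a + b) : (f₂ a = 0 ∧ f₂ b = 0) ∨
        ∃ g h : degreeZero M, f₂ a = detectorMono M g ∧ f₂ b = detectorMono M h ∧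
          monoMk M g = monoMk M (epsMono M) * monoMk M h := by
    have hle := hf₂ _ _ hab
    rw [map_zero, map_add] at hle
    rcases mem_weakResidue_mon ha with rfl | ⟨g, rfl⟩ <;>
      rcases mem_weakResidue_mon hb with rfl | ⟨h, rfl⟩
    · exact Or.inl ⟨map_zero _, map_zero _⟩
    · rw [map_zero, zero_add, hf₂'] at hle
      exact absurd hle (not_nonneg_signedMono _ _)
    · rw [map_zero, add_zero, hf₂'] at hle
      exact absurd hle (not_nonneg_signedMono _ _)
    · refine Or.inr ⟨g, h, hf₂' g, hf₂' h, ?_⟩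
      rw [hf₂', hf₂', add_comm] at hle
      exact eq_of_signedMono_add_nonneg (monoMk_eps_mul_self M) hle
  have not_zero (g : Mono M) : detectorMono M g ≠ 0 := fun h =>
    not_nonneg_signedMono (monoMk M (epsMono M)) (monoMk M g) h.ge
  refine ⟨quotLift f₂ hf₂ ?_, fun x y h => quotLift_mono _ _ _ h, hf₂'⟩
  rintro a a' ⟨ha, ha', b, hb, hab, hab'⟩
  apply le_of_eq
  rcases unique ha hb hab with ⟨h₁, h₂⟩ | ⟨g, h, h₁, h₂, h₃⟩ <;>
    rcases unique ha' hb hab' with ⟨h₁', h₂'⟩ | ⟨g', h', h₁', h₂', h₃'⟩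
  · rw [h₁, h₁']
  · exact absurd (h₂'.symm.trans h₂) (not_zero _)
  · exact absurd (h₂.symm.trans h₂') (not_zero _)
  · have hh : monoMk M h = monoMk M h' := by
      have : (MonoidAlgebra.single (monoMk M h) 1 : MonoidAlgebra ℕ (MonoQuot M)) =
        MonoidAlgebra.single (monoMk M h') 1 := h₂.symm.trans h₂'
      exact MonoidAlgebra.of_injective this
    rw [h₁, h₁', detectorMono, detectorMono, h₃, h₃', hh]

lemma isFundamental_cls_sign (M : Matroid E) (s : ℤˣ) :
    (weakUniversalPasture M).IsFundamental (cls M (signMono M s)) := by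
  have h := one_add_cls_eps_nonneg M
  -- With b = 0, the exponent of ε is chosen so that ε ^ i is the opposite sign.
  refine ⟨cls_mem M _, 0, (weakUniversalPasture M).zero_mem', _, isEps_cls_eps M, ?_⟩
  rcases Int.units_eq_one_or s with rfl | rfl
  · exact ⟨1, by rwa [map_one, map_one, add_zero, Fin.val_one, pow_one]⟩
  · exact ⟨0, by rwa [signMono_neg_one, add_zero, Fin.val_zero, pow_zero, add_comm]⟩

/-- In the binary case, the only fundamental elements are zero and the signs. -/
lemma ThreeTermMod2.eq_of_isFundamental {M : Matroid E} (H : ThreeTermMod2 M)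
    {a : (weakUniversalPasture M).Amb} (ha : (weakUniversalPasture M).IsFundamental a) :
    a = 0 ∨ ∃ s, a = cls M (signMono M s) := by
  obtain ⟨f, hf, hf'⟩ := H.exists_hom
  have pair {g h : degreeZero M} (hgh : 0 ≤ cls M g + cls M h) : cls M h = cls M (epsZero M * g) := by
    have hle := hf _ _ hgh
    rw [map_zero, map_add, hf', hf'] at hle
    have := eq_of_signedMono_add_nonneg (monoMk_eps_mul_self M) hle
    rw [← map_mul] at this
    exact monoMk_eq_iff.1 this
  -- The definition of a fundamental element allows any weak inverse of 1, so its uniqueness in the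
  -- pasture is needed.
  have sign_of_isEps {e : (weakUniversalPasture M).Amb} (he : (weakUniversalPasture M).IsEps e) :
      e = cls M (epsZero M) := by
    obtain ⟨he, hle⟩ := he
    rcases mem_weakUniversalPasture_mon he with rfl | ⟨g, rfl⟩
    · have hle := hf _ _ hle
      rw [add_zero, map_zero, ← map_one (cls M), hf'] at hle
      exact absurd hle (not_nonneg_signedMono _ _)
    · rw [← map_one (cls M)] at hle
      rw [pair hle, mul_one]
  have mass_nonneg (x : MonoidAlgebra ℕ (MonoQuot M)) (hx : @LE.le (detector M).Amb _ 0 x) :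
      Even (mass (MonoQuot M) x) := by
    obtain ⟨z, hz⟩ := hx
    have hz : x = 0 + (1 + MonoidAlgebra.single (monoMk M (epsMono M)) 1) * z := hz
    rw [hz, zero_add, map_mul, map_add, map_one, mass_single]
    exact ⟨mass _ z, by ring⟩
  have mass_mono (g : Mono M) : mass (MonoQuot M) (detectorMono M g) = 1 := mass_single _ _
  obtain ⟨ha, b, hb, e, he, i, hle⟩ := ha
  obtain ⟨s, hs⟩ : ∃ s, e ^ (i : ℕ) = cls M (signMono M s) := by
    rw [sign_of_isEps he, ← signMono_neg_one, ← map_pow, ← map_pow]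
    exact ⟨_, rfl⟩
  rw [hs] at hle
  -- If neither `a` nor `b` is zero, three monomials of mass one would have even total mass. If b =
  -- 0, then `a` is the opposite of the sign `s`.
  rcases mem_weakUniversalPasture_mon ha with rfl | ⟨g, rfl⟩
  · exact Or.inl rfl
  rcases mem_weakUniversalPasture_mon hb with rfl | ⟨h, rfl⟩
  · rw [add_zero, add_comm] at hle
    refine Or.inr ⟨-1 * s, ?_⟩
    rw [pair hle, ← signMono_neg_one, ← map_mul]
  · have hle := hf _ _ hle
    rw [map_zero, map_add, map_add, hf', hf', hf'] at hle
    have heven := mass_nonneg _ hle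
    erw [map_add, map_add] at heven
    rw [mass_mono, mass_mono, mass_mono] at heven
    exact absurd heven (by decide)

/-! ### Identification of the foundation -/

/-- The signs in the foundation. -/
noncomputable def foundSign (M : Matroid E) : ℤˣ →* (foundation M).Amb where
  toFun s := (isFundamental_cls_sign M s).toFound
  map_one' := Subtype.ext (by
    change cls M (signMono M 1) = 1
    rw [map_one, map_one])
  map_mul' s t := Subtype.ext (by
    change cls M (signMono M (s * t)) = cls M (signMono M s) * cls M (signMono M t)
    rw [map_mul, map_mul])

lemma ThreeTermMod2.mem_foundation_mon {M : Matroid E} (H : ThreeTermMod2 M)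
    {x : (foundation M).Amb} : x ∈ (foundation M).mon ↔ x = 0 ∨ ∃ s, x = foundSign M s := by
  constructor
  · intro hx
    have key : ∀ y ∈ Submonoid.closure (insert 0 {a | (weakUniversalPasture M).IsFundamental a}),
        y = 0 ∨ ∃ s, y = cls M (signMono M s) := by
      intro y hy
      induction hy using Submonoid.closure_induction with
      | mem y hy =>
        rcases hy with rfl | hy
        · exact Or.inl rfl
        · exact H.eq_of_isFundamental hy
      | one => exact Or.inr ⟨1, by rw [map_one, map_one]⟩
      | mul y z _ _ hy hz =>
        rcases hy with rfl | ⟨s, rfl⟩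
        · exact Or.inl (zero_mul _)
        rcases hz with rfl | ⟨t, rfl⟩
        · exact Or.inl (mul_zero _)
        · exact Or.inr ⟨s * t, by rw [map_mul, map_mul]⟩
    rcases key x.1 hx with h | ⟨s, h⟩
    · exact Or.inl (Subtype.ext h)
    · exact Or.inr ⟨s, Subtype.ext h⟩
  · rintro (rfl | ⟨s, rfl⟩)
    · exact (foundation M).zero_mem'
    · exact (isFundamental_cls_sign M s).toFound_mem

lemma one_add_foundSign_nonneg (M : Matroid E) : 0 ≤ 1 + foundSign M (-1) :=
  one_add_cls_eps_nonneg M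

/-- If `ε = 1` in the weak universal pasture of a binary matroid, then the foundation is `F₂`. -/
lemma ThreeTermMod2.isIso_F2 {M : Matroid E} (H : ThreeTermMod2 M)
    (hε : cls M (epsZero M) = 1) : (foundation M).IsIso F2 := by
  have hsign (s : ℤˣ) : foundSign M s = 1 := by
    rcases Int.units_eq_one_or s with rfl | rfl
    · exact map_one _
    · exact Subtype.ext hε
  obtain ⟨f, hf, -⟩ := H.exists_hom
  let ψ : (ofGroup Unit).Amb →+* (foundation M).Amb :=
    (Nat.castRingHom (foundation M).Amb).comp (mass Unit)
  have hψ (x : MonoidAlgebra ℕ Unit) : ψ x = (mass Unit x : (foundation M).Amb) := rfl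
  refine isIso_quot ψ (fun x y => ⟨fun h => ?_, fun h => h.map_le ψ (fun x y h => ?_) ?_⟩)
    fun y => ?_
  · change MonoidAlgebra ℕ Unit at x y
    have h' : ((mass Unit x : ℕ) : (weakUniversalPasture M).Amb) ≤ (mass Unit y : ℕ) := h
    have h' := hf _ _ h'
    rw [map_natCast, map_natCast] at h'
    obtain ⟨z, hz⟩ := h'
    have hz : ((mass Unit y : ℕ) : MonoidAlgebra ℕ (MonoQuot M)) =
      ((mass Unit x : ℕ) : MonoidAlgebra ℕ (MonoQuot M)) +
      (1 + MonoidAlgebra.single (monoMk M (epsMono M)) 1) * z := hz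
    have hz := congrArg (mass (MonoQuot M)) hz
    rw [map_natCast, map_add, map_natCast, map_mul, map_add, map_one, mass_single] at hz
    -- The mass of 1 + ε is 2, so the masses of `x` and `y` differ by twice that of `z`.
    have hy : y = x + (1 + 1) * (mass (MonoQuot M) z : MonoidAlgebra ℕ Unit) := by
      rw [eq_mass_of_unit y, ← Nat.cast_id (mass Unit y), hz]
      conv_rhs => rw [eq_mass_of_unit x]
      push_cast
      rw [one_add_one_eq_two]
    rw [hy]
    exact genLE_add_mul (G := Unit) ⟨rfl, rfl⟩ x _
  · exact le_of_eq (congrArg ψ h)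
  · rintro x y ⟨rfl, rfl⟩
    rw [hψ, hψ, map_zero, map_add, map_one]
    have := one_add_foundSign_nonneg M
    rw [hsign] at this
    simpa [one_add_one_eq_two] using this
  · rw [H.mem_foundation_mon]
    constructor
    · rintro (rfl | ⟨s, rfl⟩)
      · exact ⟨0, (ofGroup Unit).zero_mem', map_zero _⟩
      · exact ⟨1, one_mem _, by rw [map_one, hsign]⟩
    · rintro ⟨x, rfl | ⟨g, rfl⟩, rfl⟩
      · exact Or.inl (map_zero _)
      · exact Or.inr ⟨1, by rw [hψ, mass_single, Nat.cast_one, map_one]⟩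

/-- If `ε ≠ 1` in the weak universal pasture of a binary matroid, then the foundation is `F₁^±`. -/
lemma ThreeTermMod2.isIso_F1pm {M : Matroid E} (H : ThreeTermMod2 M)
    (hε : cls M (epsZero M) ≠ 1) : (foundation M).IsIso F1pm := by
  obtain ⟨f, hf, hf'⟩ := H.exists_hom
  let k : ℤˣ →* MonoQuot M := (monoMk M).comp ((degreeZero M).subtype.comp (signMono M))
  have hk (s : ℤˣ) : k s = monoMk M (signMono M s) := rfl
  -- This is where ε ≠ 1 enters: the signs embed in the quotient group, so coefficients at the two
  -- signs can be read off in the detector.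
  have hkε : k (-1) ≠ 1 := by
    intro h
    rw [← map_one k, hk, hk, monoMk_eq_iff, map_one, map_one] at h
    exact hε h
  have hinj : Function.Injective k := by
    rw [injective_iff_map_eq_one]
    intro s hs
    rcases Int.units_eq_one_or s with rfl | rfl
    · rfl
    · exact absurd hs hkε
  let ψ : (ofGroup ℤˣ).Amb →+* (foundation M).Amb :=
    (MonoidAlgebra.lift ℕ (foundation M).Amb ℤˣ (foundSign M)).toRingHom
  have hψ (s : ℤˣ) : ψ (MonoidAlgebra.single s 1 : MonoidAlgebra ℕ ℤˣ) = foundSign M s := by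
    change MonoidAlgebra.lift ℕ (foundation M).Amb ℤˣ (foundSign M) (MonoidAlgebra.single s 1) = _
    rw [MonoidAlgebra.lift_single, one_smul]
  have hcomp (x : MonoidAlgebra ℕ ℤˣ) : f (ψ x).1 = MonoidAlgebra.mapDomainRingHom ℕ k x := by
    induction x using MonoidAlgebra.induction_on with
    | of s =>
      rw [MonoidAlgebra.of_apply, hψ]
      change f (cls M (signMono M s)) = MonoidAlgebra.mapDomain k (MonoidAlgebra.single s 1)
      rw [hf', MonoidAlgebra.mapDomain_single]
      rfl
    | add x y hx hy =>
      rw [map_add, ← hx, ← hy]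
      exact (congrArg (fun w => f w.1) (map_add ψ x y)).trans (map_add f (ψ x).1 (ψ y).1)
    | smul n x hx =>
      rw [map_nsmul, ← hx]
      exact (congrArg (fun w => f w.1) (map_nsmul ψ n x)).trans (map_nsmul f n (ψ x).1)
  have hcoeff (x : MonoidAlgebra ℕ ℤˣ) (s : ℤˣ) :
      (MonoidAlgebra.mapDomainRingHom ℕ k x).coeff (k s) = x.coeff s :=
    Finsupp.mapDomain_apply hinj _ _
  refine isIso_quot ψ (fun x y => ⟨fun h => ?_, fun h => h.map_le ψ (fun x y h => ?_) ?_⟩)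
    fun y => ?_
  · change MonoidAlgebra ℕ ℤˣ at x y
    have h' := hf (ψ x).1 (ψ y).1 h
    rw [hcomp, hcomp] at h'
    obtain ⟨z, hz⟩ := h'
    have hz : MonoidAlgebra.mapDomainRingHom ℕ k y = MonoidAlgebra.mapDomainRingHom ℕ k x +
      (1 + MonoidAlgebra.single (k (-1)) 1) * z := hz
    have hz' (s : ℤˣ) : y.coeff s = x.coeff s + (z.coeff (k s) + z.coeff (k (-1 * s))) := by
      have := congrArg (fun w => w.coeff (k s)) hz
      simp only [MonoidAlgebra.coeff_add, Finsupp.add_apply, coeff_one_add_single_mul,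
        hcoeff] at this
      rw [this, map_mul k, ← map_inv k]
      rfl
    -- The element `z` may have support outside the signs, but only its coefficients at ±1 affect
    -- `x` and `y`. They add the same amount at both signs, so a multiple of the monomial 1 serves
    -- as witness.
    have hy : y = x + (1 + MonoidAlgebra.single (-1) 1) *
        MonoidAlgebra.single 1 (z.coeff (k 1) + z.coeff (k (-1))) := by
      ext s
      rw [MonoidAlgebra.coeff_add, Finsupp.add_apply, coeff_one_add_single_mul, hz',
        MonoidAlgebra.coeff_single]
      rcases Int.units_eq_one_or s with rfl | rfl
      · simp
      · simp [add_comm]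
    rw [hy]
    exact genLE_add_mul (G := ℤˣ) ⟨rfl, rfl⟩ x _
  · exact le_of_eq (congrArg ψ h)
  · rintro x y ⟨rfl, rfl⟩
    have : ψ (1 + MonoidAlgebra.single (-1) 1 : MonoidAlgebra ℕ ℤˣ) =
        1 + foundSign M (-1) :=
      (map_add ψ 1 _).trans (congrArg₂ (· + ·) (map_one ψ) (hψ _))
    rw [this]
    exact (map_zero ψ).le.trans (one_add_foundSign_nonneg M)
  · rw [H.mem_foundation_mon]
    constructor
    · rintro (rfl | ⟨s, rfl⟩)
      · exact ⟨0, (ofGroup ℤˣ).zero_mem', map_zero _⟩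
      · exact ⟨_, Or.inr ⟨s, rfl⟩, hψ s⟩
    · rintro ⟨x, rfl | ⟨s, rfl⟩, rfl⟩
      · exact Or.inl (map_zero _)
      · exact Or.inr ⟨s, hψ s⟩

/-- A matroid satisfies the three-term Plücker relations modulo two if and only if its foundation
is `F₁^±` or `F₂`. -/
lemma threeTermMod2_iff {M : Matroid E} :
    ThreeTermMod2 M ↔ (foundation M).IsIso F1pm ∨ (foundation M).IsIso F2 := by
  constructor
  · intro H
    by_cases hε : cls M (epsZero M) = 1
    · exact Or.inr (H.isIso_F2 hε)
    · exact Or.inl (H.isIso_F1pm hε)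
  · rintro (h | h)
    · exact threeTermMod2_of_hasParity (h.hasParity hasParity_F1pm)
    · exact threeTermMod2_of_hasParity (h.hasParity hasParity_F2)

end BinaryFoundation

theorem mainTheorem9 {E : Type u} [Finite E] [LinearOrder E] (M : Matroid E)
    (hE : M.E = Set.univ) :
    (BinaryFoundation.StronglyRepresentable M OrdBlpr.F2 ↔
      (BinaryFoundation.foundation M).IsIso OrdBlpr.F1pm ∨
        (BinaryFoundation.foundation M).IsIso OrdBlpr.F2) ∧
    (BinaryFoundation.WeaklyRepresentable M OrdBlpr.F2 ↔
      (BinaryFoundation.foundation M).IsIso OrdBlpr.F1pm ∨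
        (BinaryFoundation.foundation M).IsIso OrdBlpr.F2) := by
  rw [BinaryFoundation.stronglyRepresentable_F2_iff, BinaryFoundation.weaklyRepresentable_F2_iff,
    ← BinaryFoundation.threeTermMod2_iff]
  exact ⟨⟨fun h => h.threeTermMod2, fun h => h.pluckerMod2⟩, Iff.rfl⟩
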